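/- For integers $p\ge 1$, $n\ge 2$ let $B(s,t)=\Gamma(s)\Gamma(t)/\Gamma(s+t)$ and $$c_{p,n}=\Big(\tfrac{n-1}{2}B\big(\tfrac12,\tfrac{n-1}{2}\big)\sqrt{1-p^{-2/(n-1)}}\Big)^{2/(n-1)},\quad a_{p,n}=1-p^{-2/(n-1)}c_{p,n},\quad b_{p,n}=\tfrac{2}{n-1}\,p^{-2/(n-1)}c_{p,n},$$ $$G_n(x)=\begin{cases}\exp\!\big(-(1-\tfrac{2x}{n-1})^{(n-1)/2}\big), & x\le \tfrac{n-1}{2},\\ 1, & x>\tfrac{n-1}{2}.\end{cases}$$ 1. (Maximal independent inner product.) For each $p$ and each $n\ge 2$ let $L_1,\dots,L_p$ be i.i.d. uniformly distributed on the unit sphere $S^{n-1}\subset\mathbb R^n$, let $U$ be a random unit vector of $\mathbb R^n$, of arbitrary law, independent of $(L_1,\dots,L_p)$, and let $M_{p,n}=\max_{1\le j\le p}|\langle L_j,U\rangle|$. Then for every fixed real $x$, as $p\to\infty$, $$\sup_{n\ge 2}\Big|P\Big(\frac{M_{p,n}^2-a_{p,n}}{b_{p,n}}<x\Big)-G_n(x)\Big|\to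 0,$$ and, as $n\to\infty$ and $p\to\infty$ (double limit), $P\big((M_{p,n}^2-a_{p,n})/b_{p,n}<x\big)\to\exp(-e^{-x})$. 2. (Maximal spurious correlation.) For each $p$ and each $n\ge 3$ let $n$ i.i.d. samples be observed of independent nondegenerate Gaussian variables $X_1,\dots,X_p$ (with arbitrary means and variances) and of a random variable $Y$, of arbitrary law, independent of $(X_1,\dots,X_p)$. Let $\hat C(X_j,Y)=\frac{\sum_i (X_{ij}-\bar X_j)(Y_i-\bar Y)}{\sqrt{\sum_i (X_{ij}-\bar X_j)^2}\sqrt{\sum_i(Y_i-\bar Y)^2}}$ be the sample correlation (read as $0$ where it is undefined), let $M_{XY}=\max_{1\le j\le p}|\hat C(X_j,Y)|$, and let $D=D_{p,n}$ be the event that the observations $Y_1,\dots,Y_n$ are not all equal, so that $\hat C(X_j,Y)$ is almost surely defined on $D$. Assume $P(D)>0$, i.e. that $Y$ is not almost surely constant. Then for every fixed real $x$: (a) as $p\to\infty$, $\ \sup_{n\ge 3}\Big|P\Big(\frac{M_{XY}^2-a_{p,n-1}}{b_{p,n-1}}<x\,\Big|\,D\Big)-G_{n-1}(x)\Big|\to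 0$; (b) as $n\to\infty$ and $p\to\infty$ (double limit), $P\big((M_{XY}^2-a_{p,n-1})/b_{p,n-1}<x\,\big|\,D\big)\to\exp(-e^{-x})$; (c) if $P(D_{p,n})=1$ for all $p$ and all $n\ge3$ (i.e. if the law of $Y$ has no atoms), then (a) holds for the unconditional probability $P$; (d) if $P(D_{p,n})\to 1$ as $n,p\to\infty$ (in particular if the law of $Y$ is a fixed nondegenerate one), then (b) holds for the unconditional probability $P$. -/

import Mathlib

open MeasureTheory ProbabilityTheory Filter Topology

universe u

noncomputable section

/-- The correction factor
`c_{p,n} = ((n-1)/2 * B(1/2, (n-1)/2) * sqrt (1 - p^{-2/(n-1)}))^{2/(n-1)}`. -/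
def cConst (p n : ℕ) : ℝ :=
  (((n : ℝ) - 1) / 2 * beta (1 / 2) (((n : ℝ) - 1) / 2) *
    Real.sqrt (1 - (p : ℝ) ^ (-2 / ((n : ℝ) - 1)))) ^ (2 / ((n : ℝ) - 1))

/-- The centering constant `a_{p,n} = 1 - p^{-2/(n-1)} c_{p,n}`. -/
def aConst (p n : ℕ) : ℝ :=
  1 - (p : ℝ) ^ (-2 / ((n : ℝ) - 1)) * cConst p n

/-- The scaling constant `b_{p,n} = 2/(n-1) * p^{-2/(n-1)} c_{p,n}`. -/
def bConst (p n : ℕ) : ℝ :=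
  2 / ((n : ℝ) - 1) * (p : ℝ) ^ (-2 / ((n : ℝ) - 1)) * cConst p n

/-- The limiting distribution function in dimension `n`:
`exp (-(1 - 2x/(n-1))^{(n-1)/2})` for `x ≤ (n-1)/2`, and `1` for `x > (n-1)/2`. -/
def limitDF (n : ℕ) (x : ℝ) : ℝ :=
  if x ≤ ((n : ℝ) - 1) / 2 then
    Real.exp (-(1 - 2 / ((n : ℝ) - 1) * x) ^ (((n : ℝ) - 1) / 2))
  else 1

/-- The uniform distribution on the unit sphere of `ℝⁿ` (normalized surface measure), as a
measure on `ℝⁿ`. -/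
def uniformSphere (n : ℕ) : Measure (EuclideanSpace ℝ (Fin n)) :=
  (((volume : Measure (EuclideanSpace ℝ (Fin n))).toSphere Set.univ)⁻¹ •
    (volume : Measure (EuclideanSpace ℝ (Fin n))).toSphere).map Subtype.val

/-- `L₁, …, L_p` are i.i.d. uniform on the unit sphere of `ℝⁿ`, and `U` is a random unit vector
(of arbitrary law) independent of `(L₁, …, L_p)`. -/
structure IsSphereSample {Ω : Type u} [MeasurableSpace Ω] {p n : ℕ}
    (L : Fin p → Ω → EuclideanSpace ℝ (Fin n)) (U : Ω → EuclideanSpace ℝ (Fin n))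
    (μ : Measure Ω) : Prop where
  law_L : ∀ j, HasLaw (L j) (uniformSphere n) μ
  indep_L : iIndepFun L μ
  aemeasurable_U : AEMeasurable U μ
  norm_U : ∀ᵐ ω ∂μ, ‖U ω‖ = 1
  indep_L_U : IndepFun (fun ω j => L j ω) U μ

/-- The maximal absolute inner product `M_{p,n} = max_j |⟨L_j, U⟩|`. -/
def maxInner {Ω : Type u} {p n : ℕ} (L : Fin p → Ω → EuclideanSpace ℝ (Fin n))
    (U : Ω → EuclideanSpace ℝ (Fin n)) (ω : Ω) : ℝ :=
  ⨆ j : Fin p, |inner ℝ (L j ω) (U ω)|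

/-- The sample mean. -/
def sampleMean {n : ℕ} (u : Fin n → ℝ) : ℝ := (∑ i, u i) / n

/-- Pearson's sample correlation coefficient (`0` if one of the samples is constant, in which
case the coefficient is undefined). -/
def sampleCorr {n : ℕ} (u v : Fin n → ℝ) : ℝ :=
  (∑ i, (u i - sampleMean u) * (v i - sampleMean v)) /
    (Real.sqrt (∑ i, (u i - sampleMean u) ^ 2) * Real.sqrt (∑ i, (v i - sampleMean v) ^ 2))

/-- `n` i.i.d. observations `(X i 1, …, X i p, Y i)` of independent (nondegenerate) Gaussian
variables `X₁, …, X_p` and of a variable `Y` of arbitrary law independent of the `X_j`. -/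
structure IsGaussianSample {Ω : Type u} [MeasurableSpace Ω] {p n : ℕ}
    (X : Fin n → Fin p → Ω → ℝ) (Y : Fin n → Ω → ℝ) (μ : Measure Ω) : Prop where
  law_X : ∀ j, ∃ (m : ℝ) (v : NNReal), v ≠ 0 ∧ ∀ i, HasLaw (X i j) (gaussianReal m v) μ
  indep_X : iIndepFun (fun ij : Fin n × Fin p => X ij.1 ij.2) μ
  identDistrib_Y : ∀ i i', IdentDistrib (Y i) (Y i') μ μ
  indep_Y : iIndepFun Y μ
  indep_X_Y : IndepFun (fun ω (ij : Fin n × Fin p) => X ij.1 ij.2 ω) (fun ω i => Y i ω) μ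

/-- The maximal absolute sample correlation `M_{XY} = max_j |Ĉ(X_j, Y)|`. -/
def maxCorr {Ω : Type u} {p n : ℕ} (X : Fin n → Fin p → Ω → ℝ) (Y : Fin n → Ω → ℝ)
    (ω : Ω) : ℝ :=
  ⨆ j : Fin p, |sampleCorr (fun i => X i j ω) (fun i => Y i ω)|

/-- The event that the observations of `Y` are not all equal, so that the sample correlations
with `Y` are defined. -/
def nonconst {Ω : Type u} {n : ℕ} (Y : Fin n → Ω → ℝ) : Set Ω :=
  {ω | ∃ i i', Y i ω ≠ Y i' ω}

end

/-! Condition on `U`, respectively on the sample of `Y`. By rotation invariance the chance that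
`⟨L_j, u⟩ ^ 2 < θ` is the same for every unit vector `u`, so for `θ > 0` the distribution function
of the squared maximum is exactly `cosSqDF m θ ^ p` with `m = n - 1`. For correlations, centering is
the orthogonal projection that kills the constants, and the correlation is the cosine between the
projected samples. A projected standard Gaussian vector is standard Gaussian in dimension `n - 1`,
hence isotropic, and the same formula holds on `D` with `n - 1` in place of `n`. Both laws come from
one computation, the Gaussian measure of a cone (`stdGaussian_real_cone`), since the uniform law on
the sphere is the radial projection of the Gaussian (`uniformSphere_apply`).

What remains is analysis, uniform in `m`. Put `r = 1 - θ`, `q = p ^ (-2 / m)` and let `F` be the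
probability that `cos² ≥ θ`. Then `F` is at most `r ^ (m / 2) / (capConst m * √(1 - r))`, and at
least that quantity divided by `1 + r / ((1 - r) * m)` (`capProb_le`, `le_capProb`). At `θ = a + b
x` the constants are tuned so that `p` times this quantity equals `y * √((1 - q) / (1 - r))` with `y
= (1 - 2x/m) ^ (m / 2)`. Since `capConst m` lies between `√m` and `2√m`, one gets `|r - q| ≤ δ (1 -
q)` with `δ = corrRate (log p) x`, of order at most `log log p / log p` and free of `m`
(`abs_threshold_sub_le`). Hence `p F = y (1 + O(δ))`, while `(1 - F) ^ p` is close to `exp (-p F)`;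
as `y ≤ exp (-x)`, the total error `approxBound` does not depend on `m`. The double limit combines
this uniformity with the convergence of `limitDF n` to the Gumbel law. -/

noncomputable section

/-! ### Two-sided bounds for the normalizing constant -/

/-- The constant `(m/2) B(1/2, m/2)`. -/
def capConst (m : ℝ) : ℝ := m / 2 * beta (1 / 2) (m / 2)

lemma capConst_eq {m : ℝ} (hm : 0 < m) :
    capConst m = √Real.pi * Real.Gamma (m / 2 + 1) / Real.Gamma ((m + 1) / 2) := by
  rw [capConst, beta, Real.Gamma_one_half_eq, Real.Gamma_add_one (by positivity),
    show (1 / 2 + m / 2 : ℝ) = (m + 1) / 2 by ring]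
  ring

lemma capConst_pos {m : ℝ} (hm : 0 < m) : 0 < capConst m :=
  mul_pos (by positivity) (beta_pos (by norm_num) (by positivity))

lemma Gamma_midpoint_sq_le {s t : ℝ} (hs : 0 < s) (ht : 0 < t) :
    Real.Gamma ((s + t) / 2) ^ 2 ≤ Real.Gamma s * Real.Gamma t := by
  have h := Real.Gamma_mul_add_mul_le_rpow_Gamma_mul_rpow_Gamma hs ht
    (by norm_num : (0 : ℝ) < 1 / 2) (by norm_num : (0 : ℝ) < 1 / 2) (by norm_num)
  have hst : 0 < Real.Gamma ((s + t) / 2) := Real.Gamma_pos_of_pos (by positivity)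
  have hs' := Real.Gamma_pos_of_pos hs
  have ht' := Real.Gamma_pos_of_pos ht
  rw [← Real.sqrt_eq_rpow, ← Real.sqrt_eq_rpow, ← Real.sqrt_mul hs'.le,
    show (1 / 2 * s + 1 / 2 * t : ℝ) = (s + t) / 2 by ring] at h
  calc _ ≤ √(Real.Gamma s * Real.Gamma t) ^ 2 := by gcongr
    _ = _ := Real.sq_sqrt (by positivity)

/-- Log-convexity of Gamma at the midpoint of `m/2` and `m/2 + 1` gives `capConst m ^ 2 ≥ π m / 2`.
-/
lemma sqrt_le_capConst {m : ℝ} (hm : 0 < m) : √m ≤ capConst m := by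
  rw [capConst_eq hm]
  have h := Gamma_midpoint_sq_le (s := m / 2) (t := m / 2 + 1) (by positivity) (by positivity)
  have h1 := Real.Gamma_add_one (s := m / 2) (by positivity)
  have h2 : 0 < Real.Gamma ((m + 1) / 2) := Real.Gamma_pos_of_pos (by positivity)
  have h3 : 0 < Real.Gamma (m / 2) := Real.Gamma_pos_of_pos (by positivity)
  rw [show (m / 2 + (m / 2 + 1)) / 2 = (m + 1) / 2 by ring] at h
  rw [le_div_iff₀ h2]
  refine (sq_le_sq₀ (by positivity) (by rw [h1]; positivity)).1 ?_
  rw [mul_pow, mul_pow, Real.sq_sqrt hm.le, Real.sq_sqrt Real.pi_pos.le]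
  have hpi := Real.pi_gt_three
  rw [h1] at h ⊢
  nlinarith [mul_le_mul_of_nonneg_left h hm.le, mul_pos h3 h3, mul_pos (mul_pos hm hm) (mul_pos h3 h3)]

/-- The same argument at the midpoint of `(m+1)/2` and `(m+3)/2` gives `capConst m ^ 2 ≤ π (m + 1) /
2`. -/
lemma capConst_le {m : ℝ} (hm : 1 ≤ m) : capConst m ≤ 2 * √m := by
  have hm0 : 0 < m := by linarith
  rw [capConst_eq hm0]
  have h := Gamma_midpoint_sq_le (s := (m + 1) / 2) (t := (m + 1) / 2 + 1)
    (by positivity) (by positivity)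
  have h1 := Real.Gamma_add_one (s := (m + 1) / 2) (by positivity)
  have h2 : 0 < Real.Gamma ((m + 1) / 2) := Real.Gamma_pos_of_pos (by positivity)
  rw [show ((m + 1) / 2 + ((m + 1) / 2 + 1)) / 2 = m / 2 + 1 by ring, h1] at h
  rw [div_le_iff₀ h2]
  refine (sq_le_sq₀ (by positivity) (by positivity)).1 ?_
  rw [mul_pow, mul_pow, mul_pow, Real.sq_sqrt hm0.le, Real.sq_sqrt Real.pi_pos.le]
  have hpi := Real.pi_lt_four
  calc Real.pi * Real.Gamma (m / 2 + 1) ^ 2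
      ≤ 4 * (Real.Gamma ((m + 1) / 2) * ((m + 1) / 2 * Real.Gamma ((m + 1) / 2))) := by gcongr
    _ ≤ _ := by nlinarith [mul_pos h2 h2]

/-! ### Cap probabilities and their sandwich -/

/-- The density of the tangent of the angle to an axis, up to a constant. -/
def capDensity (m : ℕ) (τ : ℝ) : ℝ := τ ^ (m - 1) * (1 + τ ^ 2) ^ (-((m : ℝ) + 1) / 2)

/-- The probability that a uniform random line of `ℝ^(m+1)` makes with a given axis an angle
of tangent at most `κ`. -/
def capProb (m : ℕ) (κ : ℝ) : ℝ := m / capConst m * ∫ τ in (0 : ℝ)..κ, capDensity m τ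

lemma continuous_capDensity (m : ℕ) : Continuous (capDensity m) := by
  unfold capDensity
  refine (continuous_pow _).mul (Continuous.rpow_const (by fun_prop) fun τ => Or.inl ?_)
  positivity

lemma capDensity_nonneg (m : ℕ) {τ : ℝ} (hτ : 0 ≤ τ) : 0 ≤ capDensity m τ := by
  unfold capDensity; positivity

/-- An explicit primitive for the density weighted by `m + τ ^ 2`. On `[0, κ]` the weight stays
between `m` and `m + κ ^ 2`, which bounds `capProb` on both sides. -/
lemma hasDerivAt_capBound {m : ℕ} (hm : 1 ≤ m) (τ : ℝ) :
    HasDerivAt (fun τ : ℝ => τ ^ m * (1 + τ ^ 2) ^ (-((m : ℝ) - 1) / 2))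
      ((m + τ ^ 2) * capDensity m τ) τ := by
  have h0 : (0 : ℝ) < 1 + τ ^ 2 := by positivity
  have h := (hasDerivAt_pow m τ).mul
    (((hasDerivAt_pow 2 τ).const_add 1).rpow_const (p := -((m : ℝ) - 1) / 2) (Or.inl h0.ne'))
  refine HasDerivAt.congr_deriv (f := fun τ : ℝ => τ ^ m * (1 + τ ^ 2) ^ (-((m : ℝ) - 1) / 2)) h ?_
  clear h
  obtain ⟨k, rfl⟩ : ∃ k, m = k + 1 := ⟨m - 1, by omega⟩
  have e1 : (1 + τ ^ 2 : ℝ) ^ (-(((k + 1 : ℕ) : ℝ) - 1) / 2)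
      = (1 + τ ^ 2) * (1 + τ ^ 2) ^ (-(((k + 1 : ℕ) : ℝ) + 1) / 2) := by
    rw [mul_comm, ← Real.rpow_add_one h0.ne']
    congr 1; ring
  have e2 : (-(((k + 1 : ℕ) : ℝ) - 1) / 2 - 1) = (-(((k + 1 : ℕ) : ℝ) + 1) / 2) := by ring
  rw [e2, e1, capDensity]
  push_cast
  ring

lemma integral_capBound {m : ℕ} (hm : 1 ≤ m) (κ : ℝ) :
    ∫ τ in (0 : ℝ)..κ, (m + τ ^ 2) * capDensity m τ
      = κ ^ m * (1 + κ ^ 2) ^ (-((m : ℝ) - 1) / 2) := by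
  rw [intervalIntegral.integral_eq_sub_of_hasDerivAt (fun τ _ => hasDerivAt_capBound hm τ)
    ((Continuous.mul (by fun_prop) (continuous_capDensity m)).intervalIntegrable _ _)]
  simp [show m ≠ 0 by omega]

lemma capProb_nonneg (m : ℕ) {κ : ℝ} (hκ : 0 ≤ κ) : 0 ≤ capProb m κ := by
  refine mul_nonneg ?_ (intervalIntegral.integral_nonneg hκ fun τ hτ => capDensity_nonneg m hτ.1)
  rcases Nat.eq_zero_or_pos m with rfl | hm
  · simp
  · exact div_nonneg (by positivity) (capConst_pos (by positivity)).le

lemma capProb_le {m : ℕ} (hm : 1 ≤ m) {κ : ℝ} (hκ : 0 ≤ κ) :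
    capProb m κ ≤ κ ^ m * (1 + κ ^ 2) ^ (-((m : ℝ) - 1) / 2) / capConst m := by
  have hA : 0 < capConst m := capConst_pos (by positivity)
  rw [capProb, div_mul_eq_mul_div, ← integral_capBound hm, ← intervalIntegral.integral_const_mul]
  gcongr
  refine intervalIntegral.integral_mono_on hκ
    ((continuous_const.mul (continuous_capDensity m)).intervalIntegrable _ _)
    ((Continuous.mul (by fun_prop) (continuous_capDensity m)).intervalIntegrable _ _) fun τ hτ => ?_
  have := capDensity_nonneg m hτ.1
  gcongr
  nlinarith

lemma le_capProb {m : ℕ} (hm : 1 ≤ m) {κ : ℝ} (hκ : 0 ≤ κ) :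
    κ ^ m * (1 + κ ^ 2) ^ (-((m : ℝ) - 1) / 2) / capConst m
      ≤ (1 + κ ^ 2 / m) * capProb m κ := by
  have hA : 0 < capConst m := capConst_pos (by positivity)
  have hm0 : (0 : ℝ) < m := by positivity
  have : (1 + κ ^ 2 / m) * capProb m κ
      = (∫ τ in (0 : ℝ)..κ, (m + κ ^ 2) * capDensity m τ) / capConst m := by
    rw [capProb, intervalIntegral.integral_const_mul]
    field_simp
  rw [this, ← integral_capBound hm]
  gcongr
  refine intervalIntegral.integral_mono_on hκ
    ((Continuous.mul (by fun_prop) (continuous_capDensity m)).intervalIntegrable _ _)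
    ((continuous_const.mul (continuous_capDensity m)).intervalIntegrable _ _) fun τ hτ => ?_
  have := capDensity_nonneg m hτ.1
  have := hτ.1
  have := hτ.2
  gcongr

/-- Passage from the tangent to `r`, the squared sine: `1 + tan² = 1 / (1 - r)`. -/
lemma capBound_sqrt_eq {m : ℕ} {r : ℝ} (hr0 : 0 ≤ r) (hr1 : r < 1) :
    √(r / (1 - r)) ^ m * (1 + √(r / (1 - r)) ^ 2) ^ (-((m : ℝ) - 1) / 2)
      = r ^ ((m : ℝ) / 2) / √(1 - r) := by
  have h1 : 0 < 1 - r := by linarith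
  rw [Real.sq_sqrt (by positivity), show 1 + r / (1 - r) = (1 - r)⁻¹ by field_simp; ring,
    ← Real.rpow_natCast, Real.sqrt_eq_rpow, Real.sqrt_eq_rpow, ← Real.rpow_mul (by positivity),
    Real.inv_rpow h1.le, ← Real.rpow_neg h1.le, Real.div_rpow hr0 h1.le, div_mul_eq_mul_div,
    mul_div_assoc, ← Real.rpow_sub h1, div_eq_mul_inv (r ^ ((m : ℝ) / 2)), ← Real.rpow_neg h1.le]
  congr 2 <;> ring

/-! ### Control of the correction factor -/

/-- Convexity of `exp` along the chord from `0` to `t`. -/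
lemma exp_mul_sub_one_le {ε t : ℝ} (h0 : 0 ≤ ε) (h1 : ε ≤ 1) :
    Real.exp (t * ε) - 1 ≤ ε * (Real.exp t - 1) := by
  have h := convexOn_exp.2 (Set.mem_univ t) (Set.mem_univ 0) h0 (sub_nonneg.2 h1) (by ring)
  simp only [smul_eq_mul, mul_zero, add_zero, Real.exp_zero, mul_one] at h
  rw [mul_comm t]
  linarith

lemma one_sub_rpow_le_exp {m x : ℝ} (hm : 0 < m) (hx : 0 ≤ 1 - 2 / m * x) :
    (1 - 2 / m * x) ^ (m / 2) ≤ Real.exp (-x) := by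
  calc (1 - 2 / m * x) ^ (m / 2) ≤ Real.exp (-(2 / m * x)) ^ (m / 2) := by
        gcongr
        linarith [Real.add_one_le_exp (-(2 / m * x))]
    _ = Real.exp (-x) := by
        rw [← Real.exp_mul]
        congr 1
        field_simp

lemma exp_neg_two_mul_abs_le {u : ℝ} (hu : |u| ≤ 1 / 2) : Real.exp (-(2 * |u|)) ≤ 1 - u := by
  rcases le_total u 0 with h | h
  · calc Real.exp (-(2 * |u|)) ≤ 1 := Real.exp_le_one_iff.2 (by linarith [abs_nonneg u])
      _ ≤ _ := by linarith
  · rw [abs_of_nonneg h] at hu ⊢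
    have h1 : 0 < 1 - u := by linarith
    have h2 := Real.add_one_le_exp (u / (1 - u))
    have h3 : u / (1 - u) ≤ 2 * u := by
      rw [div_le_iff₀ h1]; nlinarith
    have h4 : (1 - u)⁻¹ ≤ Real.exp (2 * u) := by
      calc (1 - u)⁻¹ = u / (1 - u) + 1 := by field_simp; ring
        _ ≤ _ := h2
        _ ≤ _ := Real.exp_le_exp.2 h3
    rw [Real.exp_neg]
    exact inv_le_of_inv_le₀ h1 h4

/-- The rate at which the correction factor is under control; here `L = log p`. -/
def corrRate (L x : ℝ) : ℝ := (|Real.log (2 * √(2 * L)) - x| + (1 + 2 * |x|)) / L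

lemma tendsto_corrRate (x : ℝ) : Tendsto (fun L => corrRate L x) atTop (𝓝 0) := by
  have hlog : Tendsto (fun L : ℝ => Real.log L / L) atTop (𝓝 0) := by
    simpa using Real.tendsto_pow_log_div_mul_add_atTop 1 0 1 one_ne_zero
  have hinv : Tendsto (fun L : ℝ => L⁻¹) atTop (𝓝 0) := tendsto_inv_atTop_zero
  set K : ℝ := |Real.log 2 + Real.log 2 / 2 - x| + (1 + 2 * |x|)
  have hub : Tendsto (fun L : ℝ => Real.log L / L / 2 + K * L⁻¹) atTop (𝓝 0) := by
    simpa using (hlog.div_const 2).add (hinv.const_mul K)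
  refine tendsto_of_tendsto_of_tendsto_of_le_of_le' tendsto_const_nhds hub ?_ ?_
  · filter_upwards [eventually_ge_atTop 1] with L hL
    unfold corrRate; positivity
  · filter_upwards [eventually_ge_atTop 1] with L hL
    have hL0 : 0 < L := by linarith
    have e : Real.log (2 * √(2 * L)) = Real.log 2 + Real.log 2 / 2 + Real.log L / 2 := by
      rw [Real.log_mul (by norm_num) (by positivity), Real.log_sqrt (by positivity),
        Real.log_mul (by norm_num) (by positivity)]
      ring
    have hl : 0 ≤ Real.log L := Real.log_nonneg hL
    have h1 : |Real.log (2 * √(2 * L)) - x|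
        ≤ Real.log L / 2 + |Real.log 2 + Real.log 2 / 2 - x| := by
      rw [e, show Real.log 2 + Real.log 2 / 2 + Real.log L / 2 - x
        = Real.log L / 2 + (Real.log 2 + Real.log 2 / 2 - x) by ring]
      exact (abs_add_le _ _).trans (by rw [abs_of_nonneg (by positivity : 0 ≤ Real.log L / 2)])
    calc corrRate L x ≤ (Real.log L / 2 + K) / L := by
          unfold corrRate
          exact div_le_div_of_nonneg_right (by linarith) hL0.le
      _ = _ := by field_simp

lemma corrFactor_sub_one_le {L m x : ℝ} (hL : 1 ≤ L) (hm : 1 ≤ m) (hx : 0 ≤ 1 - 2 / m * x)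
    (hδ : corrRate L x ≤ 1) :
    (capConst m * √(1 - Real.exp (-(2 * L / m)))) ^ (2 / m) * (1 - 2 / m * x) - 1
      ≤ corrRate L x * (Real.exp (2 * L / m) - 1) := by
  have hm0 : 0 < m := by linarith
  have hL0 : 0 < L := by linarith
  have hA := capConst_pos hm0
  set t := 2 * L / m
  set g := Real.log (2 * √(2 * L)) - x
  have h1 : √(1 - Real.exp (-t)) ≤ √t := Real.sqrt_le_sqrt (by linarith [Real.add_one_le_exp (-t)])
  -- The factor `√m` cancels against `√t = √(2L/m)`, so the bound is free of `m`.
  have h2 : capConst m * √(1 - Real.exp (-t)) ≤ 2 * √(2 * L) := by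
    calc _ ≤ 2 * √m * √t := by gcongr; exact capConst_le hm
      _ = _ := by
        rw [mul_assoc, ← Real.sqrt_mul hm0.le]
        congr 2
        simp only [t]; field_simp
  have h3 : (capConst m * √(1 - Real.exp (-t))) ^ (2 / m) * (1 - 2 / m * x)
      ≤ Real.exp (t * (|g| / L)) := by
    calc _ ≤ (2 * √(2 * L)) ^ (2 / m) * Real.exp (-(2 / m * x)) := by
          gcongr
          linarith [Real.add_one_le_exp (-(2 / m * x))]
      _ = Real.exp (2 / m * g) := by
          rw [Real.rpow_def_of_pos (by positivity), ← Real.exp_add]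
          congr 1; simp only [g]; ring
      _ ≤ _ := by
          refine Real.exp_le_exp.2 ?_
          have : t * (|g| / L) = 2 / m * |g| := by simp only [t]; field_simp
          rw [this]
          gcongr
          exact le_abs_self g
  have h4 : |g| / L ≤ corrRate L x := by
    unfold corrRate
    gcongr
    linarith [abs_nonneg x]
  have ht : 0 ≤ Real.exp t - 1 := by
    have : 0 ≤ t := by positivity
    linarith [Real.add_one_le_exp t]
  have h5 := exp_mul_sub_one_le (t := t) (by positivity : 0 ≤ |g| / L) (h4.trans hδ)
  nlinarith [mul_le_mul_of_nonneg_right h4 ht]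

lemma one_sub_corrFactor_le {L m x : ℝ} (hL : 1 ≤ L) (hm : 1 ≤ m) (hx : 0 ≤ 1 - 2 / m * x) :
    1 - (capConst m * √(1 - Real.exp (-(2 * L / m)))) ^ (2 / m) * (1 - 2 / m * x)
      ≤ corrRate L x * (Real.exp (2 * L / m) - 1) := by
  have hm0 : 0 < m := by linarith
  have hL0 : 0 < L := by linarith
  have hA := capConst_pos hm0
  set t := 2 * L / m with ht_def
  have ht0 : 0 < t := by positivity
  have hexp : t ≤ Real.exp t - 1 := by linarith [Real.add_one_le_exp t]
  have hrate : (1 + 2 * |x|) / L ≤ corrRate L x := by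
    unfold corrRate
    exact div_le_div_of_nonneg_right (by linarith [abs_nonneg (Real.log (2 * √(2 * L)) - x)]) hL0.le
  have hmain : 1 - (capConst m * √(1 - Real.exp (-t))) ^ (2 / m) * (1 - 2 / m * x)
      ≤ (1 + 2 * |x|) / L * t := by
    have he : (1 + 2 * |x|) / L * t = (2 + 4 * |x|) / m := by rw [ht_def]; field_simp; ring
    rw [he]
    -- For `m < 4|x|` the right-hand side exceeds `1` and there is nothing to prove; otherwise
    -- `2x/m` is at most `1/2` in absolute value.
    rcases lt_or_ge m (4 * |x|) with h | h
    · have : 1 ≤ (2 + 4 * |x|) / m := by rw [le_div_iff₀ hm0]; linarith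
      have : 0 ≤ (capConst m * √(1 - Real.exp (-t))) ^ (2 / m) * (1 - 2 / m * x) := by positivity
      linarith
    · have hu : |2 / m * x| ≤ 1 / 2 := by
        rw [abs_mul, abs_of_pos (by positivity : 0 < 2 / m), div_mul_eq_mul_div,
          div_le_iff₀ hm0]
        linarith
      have h1 := exp_neg_two_mul_abs_le hu
      have h2 : 1 / 2 ≤ capConst m * √(1 - Real.exp (-t)) := by
        have h3 : t / (1 + t) ≤ 1 - Real.exp (-t) := by
          have : Real.exp (-t) ≤ (1 + t)⁻¹ := by
            rw [Real.exp_neg]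
            gcongr
            linarith
          have : t / (1 + t) = 1 - (1 + t)⁻¹ := by field_simp; ring
          linarith
        have h4 : (1 / 2 : ℝ) ^ 2 ≤ m * (t / (1 + t)) := by
          have : m * (t / (1 + t)) = 2 * L * m / (m + 2 * L) := by
            rw [ht_def]; field_simp
          rw [this, le_div_iff₀ (by positivity)]
          nlinarith
        calc (1 / 2 : ℝ) ≤ √(m * (t / (1 + t))) := Real.le_sqrt_of_sq_le h4
          _ = √m * √(t / (1 + t)) := Real.sqrt_mul hm0.le _
          _ ≤ _ := by
            gcongr
            exact sqrt_le_capConst hm0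
      -- Any positive lower bound for the base would do: its `2/m`-th power costs only `O(1/m)`.
      -- Here `1/2 ≥ exp (-1)`.
      have h5 : Real.exp (-(2 / m)) ≤ (capConst m * √(1 - Real.exp (-t))) ^ (2 / m) := by
        calc Real.exp (-(2 / m)) = Real.exp (-1) ^ (2 / m) := by
              rw [← Real.exp_mul]; congr 1; ring
          _ ≤ _ := by
            gcongr
            refine le_trans ?_ h2
            rw [Real.exp_neg, one_div]
            gcongr
            linarith [Real.add_one_le_exp 1]
      have h6 : Real.exp (-((2 + 4 * |x|) / m))
          ≤ (capConst m * √(1 - Real.exp (-t))) ^ (2 / m) * (1 - 2 / m * x) := by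
        calc _ = Real.exp (-(2 / m)) * Real.exp (-(2 * |2 / m * x|)) := by
              rw [← Real.exp_add, abs_mul, abs_of_pos (by positivity : 0 < 2 / m)]
              congr 1; ring
          _ ≤ _ := by gcongr
      linarith [Real.add_one_le_exp (-((2 + 4 * |x|) / m))]
  calc _ ≤ _ := hmain
    _ ≤ corrRate L x * t := by gcongr
    _ ≤ _ := by
      have : 0 ≤ corrRate L x := by unfold corrRate; positivity
      gcongr

/-! ### Poisson approximation and the centering constants -/

/-- `1 - F` and `exp (-F)` lie in `[0, 1]` and differ by at most `F ^ 2`; taking `p`-th powers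
multiplies the gap by at most `p`. -/
lemma abs_one_sub_pow_sub_exp_le {p : ℕ} {F : ℝ} (h0 : 0 ≤ F) (h1 : F ≤ 1) :
    |(1 - F) ^ p - Real.exp (-(p * F))| ≤ p * F ^ 2 := by
  have e1 : 1 - F ≤ Real.exp (-F) := by linarith [Real.add_one_le_exp (-F)]
  have e2 : Real.exp (-F) ≤ 1 - F + F ^ 2 := by
    have := Real.abs_exp_sub_one_sub_id_le (x := -F) (by rw [abs_neg, abs_of_nonneg h0]; exact h1)
    have := (abs_le.1 this).2
    nlinarith
  have e3 : Real.exp (-(p * F)) = Real.exp (-F) ^ p := by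
    rw [← Real.exp_nat_mul]; congr 1; ring
  rw [e3]
  have h := abs_pow_sub_pow_le (1 - F) (Real.exp (-F)) p
  have hmax : max |1 - F| |Real.exp (-F)| ^ (p - 1) ≤ 1 := by
    refine pow_le_one₀ (le_max_of_le_left (abs_nonneg _)) (max_le ?_ ?_)
    · rw [abs_of_nonneg (by linarith)]; linarith
    · rw [abs_of_pos (Real.exp_pos _)]
      exact Real.exp_le_one_iff.2 (by linarith)
  have habs : |1 - F - Real.exp (-F)| ≤ F ^ 2 := by
    rw [abs_le]; constructor <;> linarith
  calc _ ≤ _ := h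
    _ ≤ F ^ 2 * p * 1 := by gcongr
    _ = _ := by ring

lemma abs_exp_neg_sub_exp_neg_le {a b : ℝ} (ha : 0 ≤ a) (hb : 0 ≤ b) :
    |Real.exp (-a) - Real.exp (-b)| ≤ |a - b| := by
  wlog h : a ≤ b generalizing a b
  · rw [abs_sub_comm, abs_sub_comm a]
    exact this hb ha (le_of_not_ge h)
  have h1 : Real.exp (-b) ≤ Real.exp (-a) := Real.exp_le_exp.2 (by linarith)
  have h2 : Real.exp (-b) = Real.exp (-a) * Real.exp (a - b) := by
    rw [← Real.exp_add]; congr 1; ring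
  have h3 := Real.add_one_le_exp (a - b)
  have h4 : Real.exp (-a) ≤ 1 := Real.exp_le_one_iff.2 (by linarith)
  rw [abs_of_nonneg (by linarith), abs_sub_comm, abs_of_nonneg (by linarith), h2]
  nlinarith [Real.exp_pos (-a)]

lemma rpow_neg_two_div_eq_exp {p : ℕ} (hp : 0 < p) (m : ℝ) :
    (p : ℝ) ^ (-2 / m) = Real.exp (-(2 * Real.log p / m)) := by
  rw [Real.rpow_def_of_pos (by positivity)]
  congr 1; ring

lemma one_sub_aConst_add_bConst_mul {p m : ℕ} (hp : 0 < p) (x : ℝ) :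
    1 - (aConst p (m + 1) + bConst p (m + 1) * x)
      = Real.exp (-(2 * Real.log p / m)) *
        ((capConst m * √(1 - Real.exp (-(2 * Real.log p / m)))) ^ (2 / (m : ℝ)) *
          (1 - 2 / m * x)) := by
  have e : ((m + 1 : ℕ) : ℝ) - 1 = m := by push_cast; ring
  rw [aConst, bConst, cConst, e, rpow_neg_two_div_eq_exp hp, capConst]
  ring

lemma bConst_pos {p m : ℕ} (hp : 1 < p) (hm : 1 ≤ m) : 0 < bConst p (m + 1) := by
  have e : ((m + 1 : ℕ) : ℝ) - 1 = m := by push_cast; ring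
  have hm0 : (0 : ℝ) < m := by positivity
  have hL : 0 < Real.log p := Real.log_pos (by exact_mod_cast hp)
  rw [bConst, cConst, e, rpow_neg_two_div_eq_exp (by omega)]
  have h1 : 0 < 1 - Real.exp (-(2 * Real.log p / m)) := by
    rw [sub_pos, Real.exp_lt_one_iff]
    have : 0 < 2 * Real.log p / m := by positivity
    linarith
  have h2 : 0 < (m : ℝ) / 2 * beta (1 / 2) (m / 2) := capConst_pos hm0
  positivity

lemma limitDF_succ {m : ℕ} (hm : 1 ≤ m) {x : ℝ} (hx : 0 ≤ 1 - 2 / (m : ℝ) * x) :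
    limitDF (m + 1) x = Real.exp (-(1 - 2 / (m : ℝ) * x) ^ ((m : ℝ) / 2)) := by
  have e : ((m + 1 : ℕ) : ℝ) - 1 = m := by push_cast; ring
  have hm0 : (0 : ℝ) < m := by positivity
  rw [limitDF, e, if_pos]
  have : 2 / (m : ℝ) * x = x / (m / 2) := by field_simp
  rw [this, sub_nonneg, div_le_one (by positivity)] at hx
  exact hx

lemma limitDF_succ_of_neg {m : ℕ} (hm : 1 ≤ m) {x : ℝ} (hx : 1 - 2 / (m : ℝ) * x < 0) :
    limitDF (m + 1) x = 1 := by
  have e : ((m + 1 : ℕ) : ℝ) - 1 = m := by push_cast; ring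
  have hm0 : (0 : ℝ) < m := by positivity
  rw [limitDF, e, if_neg]
  have : 2 / (m : ℝ) * x = x / (m / 2) := by field_simp
  rw [this, sub_neg, lt_div_iff₀ (by positivity)] at hx
  linarith

/-- The bound on the distance between the law of the maximum and its limit. -/
def approxBound (p : ℕ) (x : ℝ) : ℝ :=
  4 * Real.exp (-x) ^ 2 / p + 4 * corrRate (Real.log p) x * Real.exp (-x)

lemma tendsto_approxBound (x : ℝ) : Tendsto (fun p => approxBound p x) atTop (𝓝 0) := by
  have h1 : Tendsto (fun p : ℕ => 4 * Real.exp (-x) ^ 2 / (p : ℝ)) atTop (𝓝 0) :=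
    tendsto_const_div_atTop_nhds_zero_nat _
  have h2 : Tendsto (fun p : ℕ => corrRate (Real.log p) x) atTop (𝓝 0) :=
    (tendsto_corrRate x).comp (Real.tendsto_log_atTop.comp tendsto_natCast_atTop_atTop)
  simpa [approxBound] using h1.add ((h2.const_mul 4).mul_const (Real.exp (-x)))

/-! ### Comparison at the threshold, uniformly in the dimension -/

section
variable {δ q r : ℝ}

lemma sqrt_ratio_le (hδ0 : 0 ≤ δ) (hδ : δ ≤ 1 / 4) (hq : q < 1) (h : r - q ≤ δ * (1 - q)) :
    √((1 - q) / (1 - r)) ≤ 1 + 2 * δ := by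
  have h1 : (1 - δ) * (1 - q) ≤ 1 - r := by linarith
  have hr : 0 < 1 - r := lt_of_lt_of_le (mul_pos (by linarith) (by linarith)) h1
  have h2 : 1 ≤ (1 + 2 * δ) ^ 2 * (1 - δ) := by
    have : 0 ≤ δ * (3 - 4 * δ ^ 2) := mul_nonneg hδ0 (by nlinarith)
    linarith
  rw [Real.sqrt_le_left (by linarith), div_le_iff₀ hr]
  calc 1 - q = 1 * (1 - q) := by ring
    _ ≤ (1 + 2 * δ) ^ 2 * (1 - δ) * (1 - q) := mul_le_mul_of_nonneg_right h2 (by linarith)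
    _ = (1 + 2 * δ) ^ 2 * ((1 - δ) * (1 - q)) := by ring
    _ ≤ _ := by gcongr

lemma le_sqrt_ratio (hδ0 : 0 ≤ δ) (hδ : δ ≤ 1 / 4) (hq : q < 1) (h : -(δ * (1 - q)) ≤ r - q)
    (hr : r < 1) : 1 - δ ≤ √((1 - q) / (1 - r)) := by
  have h1 : 1 - r ≤ (1 + δ) * (1 - q) := by linarith
  have h2 : (1 - δ) ^ 2 * (1 + δ) ≤ 1 := by
    have : 0 ≤ δ * (1 + δ - δ ^ 2) := mul_nonneg hδ0 (by nlinarith)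
    linarith
  refine Real.le_sqrt_of_sq_le ?_
  rw [le_div_iff₀ (by linarith)]
  calc (1 - δ) ^ 2 * (1 - r) ≤ (1 - δ) ^ 2 * ((1 + δ) * (1 - q)) := by gcongr
    _ = (1 - δ) ^ 2 * (1 + δ) * (1 - q) := by ring
    _ ≤ 1 * (1 - q) := mul_le_mul_of_nonneg_right h2 (by linarith)
    _ = _ := one_mul _

/-- Bounds `κ ^ 2 / m`, the relative gap between the two sides of the sandwich for `capProb`. -/
lemma ratio_div_le {m : ℝ} (hδ0 : 0 ≤ δ) (hδ : δ ≤ 1 / 4) (hq : q < 1) (hm : 1 ≤ m)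
    (hqm : q * 2 ≤ δ * m * (1 - q)) (h : r - q ≤ δ * (1 - q)) :
    r / (1 - r) / m ≤ 3 * δ := by
  have hq' : 0 < 1 - q := by linarith
  have h0 : 0 ≤ δ * (1 - q) := mul_nonneg hδ0 hq'.le
  have h1 : δ * (1 - q) ≤ 1 / 4 * (1 - q) := by gcongr
  have h2 : δ * (1 - q) * 1 ≤ δ * (1 - q) * m := by gcongr
  have hr : 1 / 2 * (1 - q) ≤ 1 - r := by linarith
  rw [div_div, div_le_iff₀ (mul_pos (by linarith) (by linarith))]
  calc r ≤ 3 * δ * m * (1 / 2 * (1 - q)) := by linarith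
    _ ≤ 3 * δ * m * (1 - r) := by gcongr
    _ = _ := by ring

end

section
variable {p m : ℕ} {x : ℝ}

/-- The square of the cosine of the threshold angle, subtracted from one, stays close to
`p^{-2/m}` relatively to `1 - p^{-2/m}`. -/
lemma abs_threshold_sub_le (hp : 1 ≤ Real.log p) (hm : 1 ≤ m) (hx : 0 ≤ 1 - 2 / (m : ℝ) * x)
    (hδ : corrRate (Real.log p) x ≤ 1) :
    |1 - (aConst p (m + 1) + bConst p (m + 1) * x) - Real.exp (-(2 * Real.log p / m))|
      ≤ corrRate (Real.log p) x * (1 - Real.exp (-(2 * Real.log p / m))) := by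
  have hp0 : 0 < p := by
    rcases Nat.eq_zero_or_pos p with rfl | h
    · norm_num at hp
    · exact h
  have hm1 : (1 : ℝ) ≤ m := by exact_mod_cast hm
  have h1 := corrFactor_sub_one_le hp hm1 hx hδ
  have h2 := one_sub_corrFactor_le hp hm1 hx
  rw [one_sub_aConst_add_bConst_mul hp0]
  set s := (capConst m * √(1 - Real.exp (-(2 * Real.log p / m)))) ^ (2 / (m : ℝ)) *
          (1 - 2 / m * x)
  set t := 2 * Real.log p / m
  -- Here `1 - θ = exp (-t) * s`; multiplying by `exp (-t)` turns `exp t - 1` into `1 - exp (-t)`.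
  have h3 : |s - 1| ≤ corrRate (Real.log p) x * (Real.exp t - 1) := by
    rw [abs_le]; constructor <;> linarith
  have h4 : Real.exp (-t) * Real.exp t = 1 := by rw [← Real.exp_add]; simp
  calc |Real.exp (-t) * s - Real.exp (-t)| = Real.exp (-t) * |s - 1| := by
        rw [← abs_of_pos (Real.exp_pos (-t)), ← abs_mul, abs_of_pos (Real.exp_pos (-t))]
        congr 1; ring
    _ ≤ Real.exp (-t) * (corrRate (Real.log p) x * (Real.exp t - 1)) := by gcongr
    _ = corrRate (Real.log p) x * (Real.exp (-t) * Real.exp t - Real.exp (-t)) := by ring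
    _ = _ := by rw [h4]

/-- The exponents in the constants are chosen for this cancellation: the power `m/2` produces `1/p`
and one factor `capConst m`. -/
lemma threshold_rpow (hp : 0 < p) (hm : 1 ≤ m) (hx : 0 ≤ 1 - 2 / (m : ℝ) * x) :
    p * ((1 - (aConst p (m + 1) + bConst p (m + 1) * x)) ^ ((m : ℝ) / 2) / capConst m)
      = √(1 - Real.exp (-(2 * Real.log p / m))) * (1 - 2 / (m : ℝ) * x) ^ ((m : ℝ) / 2) := by
  have hm0 : (0 : ℝ) < m := by positivity
  have hp0 : (0 : ℝ) < p := by positivity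
  have hA := capConst_pos hm0
  rw [one_sub_aConst_add_bConst_mul hp, Real.mul_rpow (by positivity) (by positivity),
    Real.mul_rpow (by positivity) hx, ← Real.rpow_mul (by positivity), ← Real.exp_mul]
  have e1 : 2 / (m : ℝ) * (m / 2) = 1 := by field_simp
  have e2 : -(2 * Real.log p / m) * ((m : ℝ) / 2) = -Real.log p := by field_simp
  rw [e1, e2, Real.exp_neg, Real.exp_log hp0, Real.rpow_one]
  field_simp

lemma threshold_mem (hp : 1 ≤ Real.log p) (hm : 1 ≤ m) (hx : 0 ≤ 1 - 2 / (m : ℝ) * x)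
    (hδ : corrRate (Real.log p) x ≤ 1 / 4) :
    aConst p (m + 1) + bConst p (m + 1) * x ∈ Set.Ioc 0 1 := by
  have hp0 : 0 < p := by
    rcases Nat.eq_zero_or_pos p with rfl | h
    · norm_num at hp
    · exact h
  have hA := capConst_pos (show (0 : ℝ) < m by positivity)
  have ht : 0 < 2 * Real.log p / m := by positivity
  have hq : Real.exp (-(2 * Real.log p / m)) < 1 := Real.exp_lt_one_iff.2 (by linarith)
  have h := (abs_le.1 (abs_threshold_sub_le hp hm hx (by linarith))).2
  constructor
  · nlinarith
  · have := one_sub_aConst_add_bConst_mul (m := m) hp0 x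
    have : 0 ≤ 1 - (aConst p (m + 1) + bConst p (m + 1) * x) := by rw [this]; positivity
    linarith

lemma abs_one_sub_capProb_pow_sub_limitDF_le (hp : 1 ≤ Real.log p) (hm : 1 ≤ m)
    (hx : 0 ≤ 1 - 2 / (m : ℝ) * x) (hδ : corrRate (Real.log p) x ≤ 1 / 4)
    (hpx : 2 * Real.exp (-x) ≤ p) {θ : ℝ} (hθ : θ = aConst p (m + 1) + bConst p (m + 1) * x) :
    |(1 - capProb m √((1 - θ) / θ)) ^ p - limitDF (m + 1) x| ≤ approxBound p x := by
  have hp0 : 0 < p := by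
    rcases Nat.eq_zero_or_pos p with rfl | h
    · norm_num at hp
    · exact h
  have hp0' : (0 : ℝ) < p := by positivity
  have hm0 : (0 : ℝ) < m := by positivity
  have hm1 : (1 : ℝ) ≤ m := by exact_mod_cast hm
  have hA := capConst_pos hm0
  obtain ⟨hθ0, hθ1⟩ := threshold_mem hp hm hx hδ
  have hcl := abs_threshold_sub_le hp hm hx (by linarith)
  have hpow := threshold_rpow hp0 hm hx
  rw [← hθ] at hθ0 hθ1 hcl hpow
  have hδ0 : 0 ≤ corrRate (Real.log p) x := by unfold corrRate; positivity
  -- This uses the summand `1` in `corrRate`; it feeds the bound on `tan² / m`.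
  have hδL : 1 / Real.log p ≤ corrRate (Real.log p) x := by
    unfold corrRate
    refine div_le_div_of_nonneg_right ?_ (by linarith)
    linarith [abs_nonneg (Real.log (2 * √(2 * Real.log p)) - x), abs_nonneg x]
  have hy0 : 0 ≤ (1 - 2 / (m : ℝ) * x) ^ ((m : ℝ) / 2) := by positivity
  have hyx := one_sub_rpow_le_exp hm0 hx
  rw [limitDF_succ hm hx]
  unfold approxBound
  set δ := corrRate (Real.log p) x
  set y := (1 - 2 / (m : ℝ) * x) ^ ((m : ℝ) / 2)
  set t := 2 * Real.log p / m with ht_def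
  set q := Real.exp (-t) with hq_def
  have ht : 0 < t := by positivity
  have hq1 : q < 1 := Real.exp_lt_one_iff.2 (by linarith)
  have hq0 : 0 < q := Real.exp_pos _
  obtain ⟨hcl1, hcl2⟩ := abs_le.1 hcl
  set F := capProb m √((1 - θ) / θ)
  set r := 1 - θ with hr_def
  have hθr : θ = 1 - r := by ring
  have hr0 : 0 ≤ r := by linarith
  have hr1 : r < 1 := by linarith
  have hub : F ≤ r ^ ((m : ℝ) / 2) / √(1 - r) / capConst m := by
    rw [← capBound_sqrt_eq hr0 hr1, ← hθr]
    exact capProb_le hm (Real.sqrt_nonneg _)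
  have hlb : r ^ ((m : ℝ) / 2) / √(1 - r) / capConst m ≤ (1 + r / (1 - r) / m) * F := by
    have := le_capProb hm (Real.sqrt_nonneg (r / (1 - r)))
    rw [capBound_sqrt_eq hr0 hr1, Real.sq_sqrt (div_nonneg hr0 (by linarith))] at this
    simpa only [F, ← hθr] using this
  have hF0 : 0 ≤ F := capProb_nonneg m (Real.sqrt_nonneg _)
  have hmid : p * (r ^ ((m : ℝ) / 2) / √(1 - r) / capConst m) = y * √((1 - q) / (1 - r)) := by
    rw [Real.sqrt_div (by linarith)]
    calc _ = p * (r ^ ((m : ℝ) / 2) / capConst m) / √(1 - r) := by ring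
      _ = _ := by rw [hpow]; ring
  have hrat1 := sqrt_ratio_le hδ0 hδ hq1 hcl2
  have hrat2 := le_sqrt_ratio hδ0 hδ hq1 hcl1 hr1
  have hq2 : q * t ≤ 1 - q := by
    have h1 : q * Real.exp t = 1 := by rw [hq_def, ← Real.exp_add]; simp
    have h2 : q * (t + 1) ≤ q * Real.exp t := by gcongr; exact Real.add_one_le_exp t
    linarith
  have hcorr : r / (1 - r) / m ≤ 3 * δ := by
    refine ratio_div_le hδ0 hδ hq1 hm1 ?_ hcl2
    have e : 1 / Real.log p = 2 / (m * t) := by rw [ht_def]; field_simp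
    rw [e, div_le_iff₀ (by positivity)] at hδL
    have h1 : q * 2 ≤ q * (δ * (m * t)) := by gcongr
    have h2 : δ * m * (q * t) ≤ δ * m * (1 - q) := by gcongr
    linarith
  have hpF1 : p * F ≤ y * (1 + 2 * δ) := by
    calc p * F ≤ p * (r ^ ((m : ℝ) / 2) / √(1 - r) / capConst m) := by gcongr
      _ = _ := hmid
      _ ≤ _ := by gcongr
  have hpF2 : y * (1 - δ) ≤ (1 + 3 * δ) * (p * F) := by
    calc y * (1 - δ) ≤ y * √((1 - q) / (1 - r)) := by gcongr
      _ = _ := hmid.symm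
      _ ≤ p * ((1 + r / (1 - r) / m) * F) := by gcongr
      _ ≤ p * ((1 + 3 * δ) * F) := by gcongr
      _ = _ := by ring
  have hpF0 : 0 ≤ p * F := by positivity
  have hdiff : |p * F - y| ≤ 4 * δ * Real.exp (-x) := by
    have h1 : |p * F - y| ≤ 4 * δ * y := by
      rw [abs_le]
      constructor
      · have hyd : 0 ≤ y * δ ^ 2 := by positivity
        -- `(1 - 4δ)(1 + 3δ) = 1 - δ - 12δ² ≤ 1 - δ`.
        have h2 : y * (1 - 4 * δ) * (1 + 3 * δ) ≤ p * F * (1 + 3 * δ) := by linarith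
        have := le_of_mul_le_mul_right h2 (by linarith)
        linarith
      · linarith [mul_nonneg hy0 hδ0]
    exact h1.trans (by gcongr)
  have hpF3 : p * F ≤ 2 * Real.exp (-x) := by
    have : y * (1 + 2 * δ) ≤ y * 2 := by gcongr; linarith
    linarith
  -- This is where `2 * exp (-x) ≤ p` is needed.
  have hF1 : F ≤ 1 := le_of_mul_le_mul_left (by linarith : p * F ≤ p * 1) hp0'
  have hfin := abs_one_sub_pow_sub_exp_le (p := p) hF0 hF1
  have hsq : p * F ^ 2 ≤ 4 * Real.exp (-x) ^ 2 / p := by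
    rw [le_div_iff₀ hp0']
    calc p * F ^ 2 * p = (p * F) ^ 2 := by ring
      _ ≤ (2 * Real.exp (-x)) ^ 2 := by gcongr
      _ = _ := by ring
  have hexp := abs_exp_neg_sub_exp_neg_le hpF0 hy0
  calc _ ≤ |(1 - F) ^ p - Real.exp (-(p * F))| + |Real.exp (-(p * F)) - Real.exp (-y)| :=
        abs_sub_le _ _ _
    _ ≤ _ := add_le_add (hfin.trans hsq) (hexp.trans hdiff)

end

/-- The distribution function of the squared cosine of the angle between a uniform random line of
`ℝ^(m+1)` and a given axis, at a positive argument. -/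
def cosSqDF (m : ℕ) (θ : ℝ) : ℝ := if θ ≤ 1 then 1 - capProb m √((1 - θ) / θ) else 1

lemma eventually_abs_cosSqDF_pow_sub_limitDF_le (x : ℝ) :
    ∀ᶠ p : ℕ in atTop, ∀ m : ℕ, 1 ≤ m →
      0 < bConst p (m + 1) ∧ 0 < aConst p (m + 1) + bConst p (m + 1) * x ∧
      |cosSqDF m (aConst p (m + 1) + bConst p (m + 1) * x) ^ p - limitDF (m + 1) x|
        ≤ approxBound p x := by
  have hlog : Tendsto (fun p : ℕ => Real.log p) atTop atTop :=
    Real.tendsto_log_atTop.comp tendsto_natCast_atTop_atTop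
  have hrate := ((tendsto_corrRate x).comp hlog).eventually_le_const
    (show (0 : ℝ) < 1 / 4 by norm_num)
  filter_upwards [hlog.eventually_ge_atTop 1, hrate, eventually_gt_atTop 1,
    tendsto_natCast_atTop_atTop.eventually_ge_atTop (2 * Real.exp (-x))] with p hp hδ hp1 hpx m hm
  have hb := bConst_pos hp1 hm
  refine ⟨hb, ?_⟩
  rcases le_or_gt 0 (1 - 2 / (m : ℝ) * x) with hx | hx
  · obtain ⟨h0, h1⟩ := threshold_mem hp hm hx hδ
    refine ⟨h0, ?_⟩
    rw [cosSqDF, if_pos h1]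
    exact abs_one_sub_capProb_pow_sub_limitDF_le hp hm hx hδ hpx rfl
  · have hm0 : (0 : ℝ) < m := by positivity
    -- Beyond the right endpoint `x = m/2` the threshold exceeds `1`, and both distribution
    -- functions equal `1`.
    have h1 : 1 < aConst p (m + 1) + bConst p (m + 1) * x := by
      have e := one_sub_aConst_add_bConst_mul (m := m) (show 0 < p by omega) x
      have hq : Real.exp (-(2 * Real.log p / m)) < 1 := by
        have : 0 < 2 * Real.log p / m := by positivity
        exact Real.exp_lt_one_iff.2 (by linarith)
      have hA := capConst_pos hm0
      have : 0 < 1 - Real.exp (-(2 * Real.log p / m)) := by linarith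
      have : 1 - (aConst p (m + 1) + bConst p (m + 1) * x) < 0 := by
        rw [e, ← mul_assoc]
        exact mul_neg_of_pos_of_neg (by positivity) hx
      linarith
    refine ⟨by linarith, ?_⟩
    rw [cosSqDF, if_neg (by linarith), limitDF_succ_of_neg hm hx, one_pow, sub_self, abs_zero]
    unfold approxBound corrRate
    positivity

lemma tendsto_limitDF (x : ℝ) :
    Tendsto (fun n : ℕ => limitDF n x) atTop (𝓝 (Real.exp (-Real.exp (-x)))) := by
  refine (tendsto_add_atTop_iff_nat 1).1 ?_
  have h1 : Tendsto (fun k : ℝ => (1 + (-x) / k) ^ k) atTop (𝓝 (Real.exp (-x))) :=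
    Real.tendsto_one_add_div_rpow_exp (-x)
  have h2 : Tendsto (fun m : ℕ => (m : ℝ) / 2) atTop atTop :=
    tendsto_natCast_atTop_atTop.atTop_div_const (by norm_num)
  have h3 := (Real.continuous_exp.tendsto _).comp (h1.comp h2).neg
  refine h3.congr' ?_
  filter_upwards [eventually_ge_atTop 1,
    tendsto_natCast_atTop_atTop.eventually_ge_atTop (2 * |x|)] with m hm hmx
  have hm0 : (0 : ℝ) < m := by positivity
  have e : 1 + -x / ((m : ℝ) / 2) = 1 - 2 / m * x := by field_simp; ring
  have hx : 0 ≤ 1 - 2 / (m : ℝ) * x := by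
    rw [div_mul_eq_mul_div, sub_nonneg, div_le_one hm0]
    linarith [le_abs_self x]
  rw [limitDF_succ hm hx]
  simp only [Function.comp_apply, e]

/-! ### The standard Gaussian measure and the uniform law on the sphere -/

section
variable (E : Type*) [NormedAddCommGroup E] [InnerProductSpace ℝ E] [FiniteDimensional ℝ E]
  [MeasurableSpace E] [BorelSpace E]

/-- The normalizing constant of the standard Gaussian density. -/
def gaussNorm (d : ℕ) : ℝ := ((2 * Real.pi) ^ ((d : ℝ) / 2))⁻¹

lemma gaussNorm_pos (d : ℕ) : 0 < gaussNorm d := by unfold gaussNorm; positivity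

/-- The standard Gaussian density as a function of the norm. -/
def gaussRadial (d : ℕ) (r : ℝ) : ℝ := gaussNorm d * Real.exp (-r ^ 2 / 2)

lemma gaussRadial_nonneg (d : ℕ) (r : ℝ) : 0 ≤ gaussRadial d r :=
  mul_nonneg (gaussNorm_pos d).le (Real.exp_pos _).le

@[fun_prop]
lemma continuous_gaussRadial (d : ℕ) : Continuous (gaussRadial d) := by
  unfold gaussRadial; fun_prop

lemma integrable_gaussRadial_norm (d : ℕ) : Integrable (fun z : E => gaussRadial d ‖z‖) := by
  have h := (GaussianFourier.integrable_cexp_neg_mul_sq_norm_add (V := E) (b := 1 / 2)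
    (by norm_num) 0 0).norm
  refine (h.const_mul (gaussNorm d)).congr (ae_of_all _ fun z => ?_)
  simp only [gaussRadial, Complex.norm_exp]
  congr 2
  simp [← Complex.ofReal_pow]
  ring

/-- Both measures have the same characteristic function. -/
lemma stdGaussian_eq_withDensity :
    stdGaussian E = (volume : Measure E).withDensity
      (fun z => ENNReal.ofReal (gaussRadial (Module.finrank ℝ E) ‖z‖)) := by
  have := isFiniteMeasure_withDensity_ofReal
    (integrable_gaussRadial_norm E (Module.finrank ℝ E)).hasFiniteIntegral
  refine Measure.ext_of_charFun ?_
  ext t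
  rw [charFun_stdGaussian, charFun_apply,
    integral_withDensity_eq_integral_toReal_smul (by fun_prop) (by simp)]
  have h := GaussianFourier.integral_cexp_neg_mul_sq_norm_add (V := E) (b := 1 / 2)
    (by norm_num) Complex.I t
  have hpi : ((Real.pi : ℂ) / (1 / 2)) ^ ((Module.finrank ℝ E : ℂ) / 2)
      = (((2 * Real.pi) ^ ((Module.finrank ℝ E : ℝ) / 2) : ℝ) : ℂ) := by
    rw [Complex.ofReal_cpow (by positivity)]
    push_cast
    congr 1
    ring
  rw [hpi] at h
  have hne : (((2 * Real.pi) ^ ((Module.finrank ℝ E : ℝ) / 2) : ℝ) : ℂ) ≠ 0 :=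
    Complex.ofReal_ne_zero.2 (by positivity)
  have h2 : ∀ z : E, (ENNReal.ofReal (gaussRadial (Module.finrank ℝ E) ‖z‖)).toReal •
      Complex.exp (inner ℝ z t * Complex.I)
      = (gaussNorm (Module.finrank ℝ E) : ℂ) *
        Complex.exp (-(1 / 2) * (‖z‖ : ℂ) ^ 2 + Complex.I * inner ℝ t z) := by
    intro z
    rw [ENNReal.toReal_ofReal (gaussRadial_nonneg _ _), gaussRadial, Complex.real_smul,
      Complex.ofReal_mul, Complex.ofReal_exp, mul_assoc, ← Complex.exp_add, real_inner_comm]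
    congr 2
    push_cast
    ring
  simp_rw [h2]
  rw [integral_const_mul, h, gaussNorm, Complex.ofReal_inv, inv_mul_cancel_left₀ hne]
  congr 1
  rw [Complex.I_sq]
  ring

variable {E}

/-- Polar coordinates: the indicator of a cone sees only the direction and `f` only the radius, so
the integral factors. -/
lemma lintegral_cone_eq [Nontrivial E] (f : ℝ → ENNReal) (hf : Measurable f)
    {S : Set E} (hS : MeasurableSet S) :
    ∫⁻ z in {z : E | ‖z‖⁻¹ • z ∈ S}, f ‖z‖
      = (volume : Measure E).toSphere (Subtype.val ⁻¹' S) *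
        ∫⁻ r : Set.Ioi (0 : ℝ), f r ∂Measure.volumeIoiPow (Module.finrank ℝ E - 1) := by
  have hm : MeasurableSet {z : E | ‖z‖⁻¹ • z ∈ S} :=
    (by fun_prop : Measurable fun z : E => ‖z‖⁻¹ • z) hS
  have hS' : MeasurableSet ((Subtype.val : Metric.sphere (0 : E) 1 → E) ⁻¹' S) :=
    measurable_subtype_coe hS
  rw [← lintegral_indicator hm]
  calc ∫⁻ z : E, {z : E | ‖z‖⁻¹ • z ∈ S}.indicator (fun z => f ‖z‖) z
      = ∫⁻ z : ({(0 : E)}ᶜ : Set E), {z : E | ‖z‖⁻¹ • z ∈ S}.indicator (fun z => f ‖z‖) z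
          ∂((volume : Measure E).comap (↑)) := by
        rw [lintegral_subtype_comap (measurableSet_singleton _).compl, restrict_compl_singleton]
    _ = ∫⁻ x : Metric.sphere (0 : E) 1 × Set.Ioi (0 : ℝ),
          (Subtype.val ⁻¹' S).indicator (fun _ => 1) x.1 * f x.2
          ∂((volume : Measure E).toSphere.prod (.volumeIoiPow (Module.finrank ℝ E - 1))) := by
        rw [← (volume : Measure E).measurePreserving_homeomorphUnitSphereProd.lintegral_comp_emb
          (Homeomorph.measurableEmbedding _)]
        refine lintegral_congr fun z => ?_
        have hiff : (homeomorphUnitSphereProd E z).1 ∈ (Subtype.val ⁻¹' S : Set _) ↔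
            (z : E) ∈ {z : E | ‖z‖⁻¹ • z ∈ S} := by
          rw [Set.mem_preimage, homeomorphUnitSphereProd_apply_fst_coe]
          rfl
        by_cases h : (z : E) ∈ {z : E | ‖z‖⁻¹ • z ∈ S}
        · simp [Set.indicator_of_mem h, Set.indicator_of_mem (hiff.2 h)]
        · simp [Set.indicator_of_notMem h, Set.indicator_of_notMem (mt hiff.1 h)]
    _ = _ := by
        rw [lintegral_prod_mul (f := (Subtype.val ⁻¹' S).indicator fun _ => 1)
          (g := fun r : Set.Ioi (0 : ℝ) => f r)
          (measurable_const.indicator hS').aemeasurable (by fun_prop),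
          lintegral_indicator_const hS', one_mul]

/-- The radial integral is common to all `S`; taking `S = univ` identifies it as the inverse of the
total surface measure. -/
lemma uniformSphere_apply {n : ℕ} (hn : 1 ≤ n) {S : Set (EuclideanSpace ℝ (Fin n))}
    (hS : MeasurableSet S) :
    uniformSphere n S = stdGaussian (EuclideanSpace ℝ (Fin n)) {z | ‖z‖⁻¹ • z ∈ S} := by
  have : Nonempty (Fin n) := ⟨⟨0, hn⟩⟩
  have hcone : ∀ S : Set (EuclideanSpace ℝ (Fin n)), MeasurableSet S →
      MeasurableSet {z : EuclideanSpace ℝ (Fin n) | ‖z‖⁻¹ • z ∈ S} := fun S hS =>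
    (by fun_prop : Measurable fun z : EuclideanSpace ℝ (Fin n) => ‖z‖⁻¹ • z) hS
  have key : ∀ S : Set (EuclideanSpace ℝ (Fin n)), MeasurableSet S →
      stdGaussian (EuclideanSpace ℝ (Fin n)) {z | ‖z‖⁻¹ • z ∈ S}
        = (volume : Measure (EuclideanSpace ℝ (Fin n))).toSphere (Subtype.val ⁻¹' S) *
        ∫⁻ r : Set.Ioi (0 : ℝ),
          ENNReal.ofReal (gaussRadial (Module.finrank ℝ (EuclideanSpace ℝ (Fin n))) r)
          ∂Measure.volumeIoiPow (Module.finrank ℝ (EuclideanSpace ℝ (Fin n)) - 1) := by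
    intro S hS
    rw [stdGaussian_eq_withDensity, withDensity_apply _ (hcone S hS)]
    exact lintegral_cone_eq
      (fun r => ENNReal.ofReal (gaussRadial (Module.finrank ℝ (EuclideanSpace ℝ (Fin n))) r))
      (by fun_prop) hS
  have huniv := key Set.univ MeasurableSet.univ
  simp only [Set.mem_univ, Set.ofPred_true, measure_univ, Set.preimage_univ] at huniv
  rw [key S hS, uniformSphere, Measure.map_apply measurable_subtype_coe hS, Measure.smul_apply,
    smul_eq_mul, mul_comm, ENNReal.eq_inv_of_mul_eq_one_left ((mul_comm _ _).trans huniv.symm)]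

lemma isProbabilityMeasure_uniformSphere {n : ℕ} (hn : 1 ≤ n) :
    IsProbabilityMeasure (uniformSphere n) :=
  ⟨by rw [uniformSphere_apply hn MeasurableSet.univ]; simp⟩

/-- The mass that the standard Gaussian measure gives to a ball. -/
lemma stdGaussian_real_closedBall {m : ℕ} (hm : 1 ≤ m) {R : ℝ} (hR : 0 ≤ R) :
    (stdGaussian (EuclideanSpace ℝ (Fin m))).real (Metric.closedBall 0 R)
      = m * (√Real.pi ^ m / Real.Gamma (m / 2 + 1)) *
        ∫ ρ in (0 : ℝ)..R, ρ ^ (m - 1) * gaussRadial m ρ := by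
  have : Nonempty (Fin m) := ⟨⟨0, hm⟩⟩
  have hG : 0 < Real.Gamma ((m : ℝ) / 2 + 1) := Real.Gamma_pos_of_pos (by positivity)
  have h1 : (stdGaussian (EuclideanSpace ℝ (Fin m))).real (Metric.closedBall 0 R)
      = ∫ z : EuclideanSpace ℝ (Fin m), (Set.Iic R).indicator (gaussRadial m) ‖z‖ := by
    rw [measureReal_def, stdGaussian_eq_withDensity,
      withDensity_apply _ Metric.isClosed_closedBall.measurableSet, finrank_euclideanSpace_fin,
      ← ofReal_integral_eq_lintegral_ofReal (integrable_gaussRadial_norm _ m).integrableOn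
        (ae_of_all _ fun z => gaussRadial_nonneg _ _), ENNReal.toReal_ofReal
        (integral_nonneg fun z => gaussRadial_nonneg _ _),
      ← integral_indicator Metric.isClosed_closedBall.measurableSet]
    refine integral_congr_ae (ae_of_all _ fun z => ?_)
    simp [Set.indicator]
  have h2 : (volume : Measure (EuclideanSpace ℝ (Fin m))).real (Metric.ball 0 1)
      = √Real.pi ^ m / Real.Gamma (m / 2 + 1) := by
    rw [measureReal_def, EuclideanSpace.volume_ball]
    simp only [ENNReal.ofReal_one, one_pow, one_mul, Fintype.card_fin]
    exact ENNReal.toReal_ofReal (by positivity)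
  rw [h1, integral_fun_norm_addHaar, h2, finrank_euclideanSpace_fin,
    intervalIntegral.integral_of_le hR, nsmul_eq_mul, smul_eq_mul, mul_assoc]
  congr 2
  rw [← integral_indicator measurableSet_Ioi, ← integral_indicator measurableSet_Ioc]
  congr 1
  ext ρ
  by_cases h : 0 < ρ <;> by_cases h' : ρ ≤ R <;> simp [Set.indicator, h, h']

end

/-! ### The Gaussian measure of a cone -/

/-- Complete `v` to an orthonormal basis: the coordinate along `v` is independent of the other `m`,
which form a standard Gaussian vector. -/
lemma stdGaussian_cone_eq_prod {E : Type*} [NormedAddCommGroup E] [InnerProductSpace ℝ E]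
    [FiniteDimensional ℝ E] [MeasurableSpace E] [BorelSpace E] {m : ℕ}
    (hE : Module.finrank ℝ E = m + 1) {v : E} (hv : ‖v‖ = 1) (θ : ℝ) :
    stdGaussian E {z | inner ℝ z v ^ 2 < θ * ‖z‖ ^ 2}
      = ((gaussianReal 0 1).prod (stdGaussian (EuclideanSpace ℝ (Fin m))))
        {x | x.1 ^ 2 < θ * (x.1 ^ 2 + ‖x.2‖ ^ 2)} := by
  obtain ⟨b, hb⟩ := Orthonormal.exists_orthonormalBasis_extension_of_card_eq (𝕜 := ℝ)
    (ι := Fin (m + 1)) (by simpa using hE) (v := fun _ => v) (s := {0})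
    (by
      rw [orthonormal_subsingleton_iff]
      intro i
      exact hv)
  have hb0 : b 0 = v := hb 0 rfl
  have hmp := (measurePreserving_piFinSuccAbove (fun _ : Fin (m + 1) => gaussianReal 0 1) 0)
  have hmp2 : MeasurePreserving (Prod.map id (WithLp.toLp 2))
      ((gaussianReal 0 1).prod (Measure.pi fun _ : Fin m => gaussianReal 0 1))
      ((gaussianReal 0 1).prod (stdGaussian (EuclideanSpace ℝ (Fin m)))) := by
    refine (MeasurePreserving.id _).prod ⟨by fun_prop, map_pi_eq_stdGaussian⟩
  have hS : MeasurableSet {x : ℝ × EuclideanSpace ℝ (Fin m) |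
      x.1 ^ 2 < θ * (x.1 ^ 2 + ‖x.2‖ ^ 2)} := measurableSet_lt (by fun_prop) (by fun_prop)
  have hT : MeasurableSet {z : E | inner ℝ z v ^ 2 < θ * ‖z‖ ^ 2} :=
    measurableSet_lt (by fun_prop) (by fun_prop)
  rw [stdGaussian_eq_map_pi_orthonormalBasis b, Measure.map_apply (by fun_prop) hT,
    ← (hmp2.comp hmp).measure_preimage hS.nullMeasurableSet]
  congr 1
  ext x
  have h1 : inner ℝ (∑ i, x i • b i) v = x 0 := by
    rw [← hb0, sum_inner]
    simp [inner_smul_left, OrthonormalBasis.inner_eq_ite]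
  have h2 : ‖∑ i, x i • b i‖ ^ 2 = ∑ i, x i ^ 2 := by
    rw [← b.sum_sq_norm_inner_right]
    refine Finset.sum_congr rfl fun i _ => ?_
    simp [inner_sum, inner_smul_right, OrthonormalBasis.inner_eq_ite]
  have h3 : ‖∑ i, x i • b i‖ ^ 2 = x 0 ^ 2 + ∑ i : Fin m, x i.succ ^ 2 := by
    rw [h2, Fin.sum_univ_succ]
  simp only [Set.mem_preimage, Set.mem_ofPred_eq, h1, h3, Function.comp_apply,
    EuclideanSpace.real_norm_sq_eq]
  rfl

lemma integral_abs_pow_mul_exp (m : ℕ) {b : ℝ} (hb : 0 < b) :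
    ∫ a : ℝ, |a| ^ m * Real.exp (-b * |a| ^ 2)
      = b ^ (-((m : ℝ) + 1) / 2) * Real.Gamma (((m : ℝ) + 1) / 2) := by
  have h := integral_rpow_mul_exp_neg_mul_rpow (p := 2) (q := m) (b := b) (by norm_num)
    (by linarith [m.cast_nonneg (α := ℝ)]) hb
  simp only [Real.rpow_natCast, Real.rpow_two] at h
  rw [integral_comp_abs (f := fun a => a ^ m * Real.exp (-b * a ^ 2)), h]
  ring

lemma stdGaussian_real_closedBall_mul_abs {m : ℕ} (hm : 1 ≤ m) {κ : ℝ} (hκ : 0 ≤ κ) (a : ℝ) :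
    (stdGaussian (EuclideanSpace ℝ (Fin m))).real (Metric.closedBall 0 (κ * |a|))
      = m * (√Real.pi ^ m / Real.Gamma (m / 2 + 1)) * gaussNorm m *
        ∫ τ in (0 : ℝ)..κ, |a| ^ m * (τ ^ (m - 1) * Real.exp (-(|a| * τ) ^ 2 / 2)) := by
  rw [stdGaussian_real_closedBall hm (by positivity), mul_assoc _ (gaussNorm m)]
  congr 1
  have h := intervalIntegral.smul_integral_comp_mul_left (a := 0) (b := κ)
    (fun ρ : ℝ => ρ ^ (m - 1) * gaussRadial m ρ) |a|
  rw [mul_zero, mul_comm |a| κ] at h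
  rw [← h, smul_eq_mul, ← intervalIntegral.integral_const_mul,
    ← intervalIntegral.integral_const_mul]
  congr 1
  ext τ
  obtain ⟨k, rfl⟩ : ∃ k, m = k + 1 := ⟨m - 1, by omega⟩
  rw [gaussRadial, Nat.add_sub_cancel]
  ring

lemma capProb_constant {m : ℕ} (hm : 1 ≤ m) :
    m * (√Real.pi ^ m / Real.Gamma (m / 2 + 1)) * gaussNorm m * (√(2 * Real.pi))⁻¹ *
      (2 ^ (((m : ℝ) + 1) / 2) * Real.Gamma (((m : ℝ) + 1) / 2)) = m / capConst m := by
  have hm0 : (0 : ℝ) < m := by positivity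
  have hG : 0 < Real.Gamma ((m : ℝ) / 2 + 1) := Real.Gamma_pos_of_pos (by positivity)
  have hG' : 0 < Real.Gamma (((m : ℝ) + 1) / 2) := Real.Gamma_pos_of_pos (by positivity)
  rw [capConst_eq hm0, gaussNorm]
  have e1 : (2 * Real.pi) ^ ((m : ℝ) / 2) = (√2) ^ m * √Real.pi ^ m := by
    rw [← mul_pow, ← Real.sqrt_mul (by norm_num), Real.sqrt_eq_rpow, ← Real.rpow_natCast,
      ← Real.rpow_mul (by positivity)]
    congr 1; ring
  have e2 : (2 : ℝ) ^ (((m : ℝ) + 1) / 2) = (√2) ^ m * √2 := by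
    rw [← pow_succ, Real.sqrt_eq_rpow, ← Real.rpow_natCast, ← Real.rpow_mul (by positivity)]
    congr 1; push_cast; ring
  rw [e1, e2, Real.sqrt_mul (by norm_num)]
  field_simp

/-- Given the first coordinate `a`, the event is a ball of radius `κ|a|`. The substitution `ρ = |a|
τ` makes the range independent of `a`; after Fubini the integral over `a` is a Gamma integral and
leaves `capDensity`. -/
lemma gaussian_prod_real_cone {m : ℕ} (hm : 1 ≤ m) {κ : ℝ} (hκ : 0 ≤ κ) :
    ((gaussianReal 0 1).prod (stdGaussian (EuclideanSpace ℝ (Fin m)))).real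
      {x | ‖x.2‖ ≤ κ * |x.1|} = capProb m κ := by
  have hS : MeasurableSet {x : ℝ × EuclideanSpace ℝ (Fin m) | ‖x.2‖ ≤ κ * |x.1|} :=
    measurableSet_le (by fun_prop) (by fun_prop)
  set C : ℝ := m * (√Real.pi ^ m / Real.Gamma (m / 2 + 1)) * gaussNorm m with hC
  have hint : Integrable (fun x : ℝ × ℝ => (|x.2| ^ m * Real.exp (-(1 / 2) * |x.2| ^ 2)) *
      (x.1 ^ (m - 1) * Real.exp (-(1 / 2) * (|x.2| * x.1) ^ 2)))
      ((volume.restrict (Set.uIoc 0 κ)).prod volume) := by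
    have h1 : Integrable (fun a : ℝ => |a| ^ m * Real.exp (-(1 / 2) * |a| ^ 2)) := by
      have := (integrable_rpow_mul_exp_neg_mul_sq (b := 1 / 2) (by norm_num) (s := m)
        (by linarith [m.cast_nonneg (α := ℝ)])).norm
      refine this.congr (ae_of_all _ fun a => ?_)
      simp [Real.abs_exp]
    have h2 : Integrable (fun τ : ℝ => τ ^ (m - 1)) (volume.restrict (Set.uIoc 0 κ)) :=
      ((continuous_pow (m - 1)).intervalIntegrable 0 κ).def'
    refine (h2.mul_prod h1).norm.mono' (by fun_prop) (ae_of_all _ fun x => ?_)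
    have : Real.exp (-(1 / 2) * (|x.2| * x.1) ^ 2) ≤ 1 :=
      Real.exp_le_one_iff.2 (by nlinarith [sq_nonneg (|x.2| * x.1)])
    simp only [norm_mul, Real.norm_eq_abs, Real.abs_exp, abs_pow, abs_abs]
    have h3 : 0 ≤ |x.2| ^ m * Real.exp (-(1 / 2) * |x.2| ^ 2) * |x.1| ^ (m - 1) := by positivity
    calc _ = |x.2| ^ m * Real.exp (-(1 / 2) * |x.2| ^ 2) * |x.1| ^ (m - 1) *
          Real.exp (-(1 / 2) * (|x.2| * x.1) ^ 2) := by ring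
      _ ≤ |x.2| ^ m * Real.exp (-(1 / 2) * |x.2| ^ 2) * |x.1| ^ (m - 1) * 1 := by gcongr
      _ = _ := by ring
  calc ((gaussianReal 0 1).prod (stdGaussian (EuclideanSpace ℝ (Fin m)))).real {x | ‖x.2‖ ≤ κ * |x.1|}
      = ∫ a, (stdGaussian (EuclideanSpace ℝ (Fin m))).real (Metric.closedBall 0 (κ * |a|))
          ∂gaussianReal 0 1 := by
        rw [measureReal_def, Measure.prod_apply hS, ← integral_toReal
          (measurable_measure_prodMk_left hS).aemeasurable (ae_of_all _ fun _ => measure_lt_top _ _)]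
        refine integral_congr_ae (ae_of_all _ fun a => ?_)
        simp only [measureReal_def]
        congr 2
        ext w
        simp
    _ = ∫ a, (C * (√(2 * Real.pi))⁻¹) * ∫ τ in (0 : ℝ)..κ,
          (|a| ^ m * Real.exp (-(1 / 2) * |a| ^ 2)) *
            (τ ^ (m - 1) * Real.exp (-(1 / 2) * (|a| * τ) ^ 2)) := by
        rw [integral_gaussianReal_eq_integral_smul one_ne_zero]
        congr 1
        ext a
        rw [stdGaussian_real_closedBall_mul_abs hm hκ, gaussianPDFReal, smul_eq_mul, ← hC,
          ← intervalIntegral.integral_const_mul, ← intervalIntegral.integral_const_mul,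
          ← intervalIntegral.integral_const_mul]
        congr 1
        ext τ
        have e : Real.exp (-(a - 0) ^ 2 / (2 * ((1 : NNReal) : ℝ)))
            = Real.exp (-(1 / 2) * |a| ^ 2) := by
          rw [sq_abs]; congr 1; simp; ring
        rw [e, show -(|a| * τ) ^ 2 / 2 = -(1 / 2) * (|a| * τ) ^ 2 by ring]
        simp only [NNReal.coe_one, mul_one]
        ring
    _ = (C * (√(2 * Real.pi))⁻¹) * ∫ τ in (0 : ℝ)..κ, ∫ a,
          (|a| ^ m * Real.exp (-(1 / 2) * |a| ^ 2)) *
            (τ ^ (m - 1) * Real.exp (-(1 / 2) * (|a| * τ) ^ 2)) := by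
        rw [integral_const_mul, intervalIntegral_integral_swap hint]
    _ = (C * (√(2 * Real.pi))⁻¹) * ∫ τ in (0 : ℝ)..κ,
          (2 ^ (((m : ℝ) + 1) / 2) * Real.Gamma (((m : ℝ) + 1) / 2)) * capDensity m τ := by
        congr 2
        ext τ
        have h1 : ∀ a : ℝ, (|a| ^ m * Real.exp (-(1 / 2) * |a| ^ 2)) *
            (τ ^ (m - 1) * Real.exp (-(1 / 2) * (|a| * τ) ^ 2))
            = τ ^ (m - 1) * (|a| ^ m * Real.exp (-((1 + τ ^ 2) / 2) * |a| ^ 2)) := by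
          intro a
          rw [show -((1 + τ ^ 2) / 2) * |a| ^ 2
            = -(1 / 2) * |a| ^ 2 + -(1 / 2) * (|a| * τ) ^ 2 by ring, Real.exp_add]
          ring
        simp_rw [h1]
        rw [integral_const_mul, integral_abs_pow_mul_exp m (by positivity), capDensity,
          Real.div_rpow (by positivity) (by norm_num), neg_div, Real.rpow_neg (by norm_num : (0:ℝ) ≤ 2)]
        field_simp
    _ = capProb m κ := by
        rw [intervalIntegral.integral_const_mul, ← mul_assoc, hC, capProb_constant hm, capProb]

lemma stdGaussian_real_cone {E : Type*} [NormedAddCommGroup E] [InnerProductSpace ℝ E]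
    [FiniteDimensional ℝ E] [MeasurableSpace E] [BorelSpace E] {m : ℕ} (hm : 1 ≤ m)
    (hE : Module.finrank ℝ E = m + 1) {v : E} (hv : ‖v‖ = 1) {θ : ℝ} (hθ : 0 < θ) :
    (stdGaussian E).real {z | inner ℝ z v ^ 2 < θ * ‖z‖ ^ 2} = cosSqDF m θ := by
  have hS : MeasurableSet {x : ℝ × EuclideanSpace ℝ (Fin m) |
      x.1 ^ 2 < θ * (x.1 ^ 2 + ‖x.2‖ ^ 2)} := measurableSet_lt (by fun_prop) (by fun_prop)
  rw [measureReal_def, stdGaussian_cone_eq_prod hE hv, ← measureReal_def, cosSqDF]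
  split_ifs with h
  · rw [← gaussian_prod_real_cone hm (Real.sqrt_nonneg _), ← probReal_compl_eq_one_sub
      (measurableSet_le (by fun_prop) (by fun_prop))]
    congr 1
    ext x
    simp only [Set.mem_compl_iff, Set.mem_ofPred_eq, not_le]
    have h0 : 0 ≤ (1 - θ) / θ := div_nonneg (sub_nonneg.2 h) hθ.le
    rw [← sq_lt_sq₀ (by positivity) (norm_nonneg _), mul_pow, Real.sq_sqrt h0, sq_abs,
      div_mul_eq_mul_div, div_lt_iff₀ hθ]
    constructor <;> intro h <;> linarith
  · have : NullSingletonClass (gaussianReal 0 1) := nullSingletonClass_gaussianReal one_ne_zero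
    refine (prob_compl_eq_zero_iff hS).1 ?_ |> fun h => by rw [measureReal_def, h]; rfl
    -- For `θ > 1` the inequality can fail only where the first coordinate vanishes, a null set.
    refine measure_mono_null (t := {0} ×ˢ Set.univ) ?_ 
      (by rw [Measure.prod_prod, measure_singleton, zero_mul])
    intro x hx
    simp only [Set.mem_compl_iff, Set.mem_ofPred_eq, not_lt] at hx
    have : x.1 ^ 2 ≤ 0 := by nlinarith [sq_nonneg x.1, sq_nonneg ‖x.2‖]
    simpa using this

section
variable {E : Type*} [NormedAddCommGroup E] [InnerProductSpace ℝ E]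
    [FiniteDimensional ℝ E] [MeasurableSpace E] [BorelSpace E]

lemma stdGaussian_singleton_zero [Nontrivial E] : stdGaussian E {0} = 0 := by
  rw [stdGaussian_eq_withDensity]
  exact withDensity_absolutelyContinuous _ _ (measure_singleton _)

/-- The origin is null, so conventions for dividing by a zero norm do not matter. -/
lemma stdGaussian_apply_of_iff {m : ℕ} (hm : 1 ≤ m) (hE : Module.finrank ℝ E = m + 1) {v : E}
    (hv : ‖v‖ = 1) {θ : ℝ} (hθ : 0 < θ) {T : Set E}
    (hT : ∀ z ≠ 0, z ∈ T ↔ inner ℝ z v ^ 2 < θ * ‖z‖ ^ 2) :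
    stdGaussian E T = ENNReal.ofReal (cosSqDF m θ) := by
  have : Nontrivial E := ⟨v, 0, by rintro rfl; simp at hv⟩
  rw [← stdGaussian_real_cone hm hE hv hθ, ofReal_measureReal]
  refine measure_congr ?_
  have h0 : ∀ᵐ z ∂stdGaussian E, z ≠ 0 := by
    rw [ae_iff]
    simpa using stdGaussian_singleton_zero (E := E)
  filter_upwards [h0] with z hz
  exact propext (hT z hz)

/-- The orthogonal projection of a standard Gaussian vector is standard Gaussian. -/
lemma stdGaussian_map_orthogonalProjectionOnto (W : Submodule ℝ E) :
    (stdGaussian E).map W.orthogonalProjectionOnto = stdGaussian W := by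
  have : IsProbabilityMeasure ((stdGaussian E).map W.orthogonalProjectionOnto) :=
    Measure.isProbabilityMeasure_map (by fun_prop)
  refine Measure.ext_of_charFun ?_
  ext t
  rw [charFun_stdGaussian, charFun_apply, integral_map (by fun_prop)
    (Measurable.aestronglyMeasurable (by fun_prop))]
  have h : ∀ z : E, inner ℝ (W.orthogonalProjectionOnto z) t = inner ℝ z (t : E) := fun z => by
    rw [real_inner_comm, Submodule.inner_orthogonalProjectionOnto_eq_of_mem_left, real_inner_comm]
  simp_rw [h]
  rw [← charFun_apply, charFun_stdGaussian]
  rfl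

end

lemma uniformSphere_cap {m : ℕ} (hm : 1 ≤ m) {u : EuclideanSpace ℝ (Fin (m + 1))} (hu : ‖u‖ = 1)
    {θ : ℝ} (hθ : 0 < θ) :
    uniformSphere (m + 1) {l | |inner ℝ l u| ^ 2 < θ} = ENNReal.ofReal (cosSqDF m θ) := by
  rw [uniformSphere_apply (by omega) (measurableSet_lt (by fun_prop) (by fun_prop))]
  refine stdGaussian_apply_of_iff hm (by simp) hu hθ fun z hz => ?_
  have hz' : 0 < ‖z‖ := norm_pos_iff.2 hz
  simp only [Set.mem_ofPred_eq, inner_smul_left, sq_abs, mul_pow]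
  simp only [conj_trivial, inv_pow]
  rw [inv_mul_lt_iff₀ (by positivity), mul_comm]

/-! ### Sample correlation as a cosine between projections -/

section sampleCorr
variable {n : ℕ}

lemma sampleMean_affine (hn : n ≠ 0) (s c : ℝ) (z : Fin n → ℝ) :
    sampleMean (fun i => s * z i + c) = s * sampleMean z + c := by
  simp only [sampleMean, Finset.sum_add_distrib, ← Finset.mul_sum, Finset.sum_const,
    Finset.card_univ, Fintype.card_fin, nsmul_eq_mul]
  have : (n : ℝ) ≠ 0 := by exact_mod_cast hn
  field_simp

lemma sampleCorr_affine (hn : n ≠ 0) {s : ℝ} (hs : 0 < s) (c : ℝ) (z y : Fin n → ℝ) :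
    sampleCorr (fun i => s * z i + c) y = sampleCorr z y := by
  have h1 : ∀ i, s * z i + c - (s * sampleMean z + c) = s * (z i - sampleMean z) :=
    fun i => by ring
  simp only [sampleCorr, sampleMean_affine hn, h1, mul_pow, mul_assoc, ← Finset.mul_sum]
  rw [Real.sqrt_mul (by positivity), Real.sqrt_sq hs.le, mul_assoc, mul_div_mul_left _ _ hs.ne']

/-- The vector with all coordinates equal to one. -/
def onesVector (n : ℕ) : EuclideanSpace ℝ (Fin n) := WithLp.toLp 2 fun _ => 1

/-- Centering a sample is projecting it on the orthogonal complement of the constants. -/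
lemma orthogonalProjectionOnto_ones_apply (hn : n ≠ 0) (z : EuclideanSpace ℝ (Fin n)) (i : Fin n) :
    ((ℝ ∙ onesVector n)ᗮ.orthogonalProjectionOnto z : EuclideanSpace ℝ (Fin n)) i
      = z i - sampleMean z := by
  have hn' : (n : ℝ) ≠ 0 := by exact_mod_cast hn
  have h : ((ℝ ∙ onesVector n)ᗮ.orthogonalProjectionOnto z : EuclideanSpace ℝ (Fin n))
      = WithLp.toLp 2 fun i => z i - sampleMean z := by
    rw [← Submodule.starProjection_apply]
    refine Submodule.eq_starProjection_of_mem_orthogonal ?_ ?_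
    · rw [Submodule.mem_orthogonal_singleton_iff_inner_right]
      simp only [onesVector, PiLp.inner_apply, sampleMean, RCLike.inner_apply, conj_trivial,
        mul_one, Finset.sum_sub_distrib, Finset.sum_const, Finset.card_univ, Fintype.card_fin,
        nsmul_eq_mul]
      field_simp
      ring
    · rw [Submodule.orthogonal_orthogonal, Submodule.mem_span_singleton]
      refine ⟨sampleMean z, ?_⟩
      ext i
      simp [onesVector]
  rw [h]

lemma sampleCorr_eq_inner_div (hn : n ≠ 0) (z y : EuclideanSpace ℝ (Fin n)) :
    sampleCorr z y = inner ℝ ((ℝ ∙ onesVector n)ᗮ.orthogonalProjectionOnto z)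
        ((ℝ ∙ onesVector n)ᗮ.orthogonalProjectionOnto y) /
      (‖(ℝ ∙ onesVector n)ᗮ.orthogonalProjectionOnto z‖ *
        ‖(ℝ ∙ onesVector n)ᗮ.orthogonalProjectionOnto y‖) := by
  rw [Submodule.coe_inner, ← Submodule.norm_coe, ← Submodule.norm_coe, EuclideanSpace.norm_eq,
    EuclideanSpace.norm_eq, PiLp.inner_apply]
  simp only [orthogonalProjectionOnto_ones_apply hn, sampleCorr, RCLike.inner_apply, conj_trivial,
    Real.norm_eq_abs, sq_abs]
  simp only [mul_comm]

@[fun_prop]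
lemma measurable_sampleCorr :
    Measurable fun xy : (Fin n → ℝ) × (Fin n → ℝ) => sampleCorr xy.1 xy.2 := by
  unfold sampleCorr sampleMean
  fun_prop

/-- The law of the squared sample correlation of a Gaussian sample with a fixed nonconstant
sample. -/
lemma pi_gaussianReal_sampleCorr {m : ℕ} (hm : 1 ≤ m) (μ₀ : ℝ) {v : NNReal} (hv : v ≠ 0)
    {y : Fin (m + 2) → ℝ} (hy : ∃ i i', y i ≠ y i') {θ : ℝ} (hθ : 0 < θ) :
    Measure.pi (fun _ : Fin (m + 2) => gaussianReal μ₀ v) {x | |sampleCorr x y| ^ 2 < θ}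
      = ENNReal.ofReal (cosSqDF m θ) := by
  set W := (ℝ ∙ onesVector (m + 2))ᗮ with hW
  have hn : m + 2 ≠ 0 := by omega
  have hs : 0 < √(v : ℝ) := Real.sqrt_pos.2 (by positivity)
  have hS : MeasurableSet {x : Fin (m + 2) → ℝ | |sampleCorr x y| ^ 2 < θ} := by
    refine measurableSet_lt ?_ measurable_const
    simp only [sq_abs]
    exact (measurable_sampleCorr.comp (measurable_id.prodMk measurable_const)).pow_const 2
  -- Mean and variance drop out by affine invariance, which reduces the claim to standard Gaussian
  -- samples.
  have hg : gaussianReal μ₀ v = (gaussianReal 0 1).map fun z => √(v : ℝ) * z + μ₀ := by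
    have : (fun z => √(v : ℝ) * z + μ₀) = (fun z => z + μ₀) ∘ fun z => √(v : ℝ) * z := rfl
    rw [this, ← Measure.map_map (by fun_prop) (by fun_prop), gaussianReal_map_const_mul,
      gaussianReal_map_add_const]
    congr 1
    · simp
    · ext; simp
  have hpi : Measure.pi (fun _ : Fin (m + 2) => gaussianReal μ₀ v)
      = (Measure.pi fun _ : Fin (m + 2) => gaussianReal 0 1).map
        (fun z i => √(v : ℝ) * z i + μ₀) := by
    have : IsProbabilityMeasure ((gaussianReal 0 1).map fun z => √(v : ℝ) * z + μ₀) := by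
      rw [← hg]; infer_instance
    rw [hg]
    exact (Measure.pi_map_pi (f := fun _ z => √(v : ℝ) * z + μ₀) fun _ => by fun_prop).symm
  set Py := W.orthogonalProjectionOnto (WithLp.toLp 2 y) with hPy
  -- A zero projection would make every `y i` equal to the sample mean.
  have hPy0 : Py ≠ 0 := by
    intro h
    obtain ⟨i, i', hi⟩ := hy
    have h1 := orthogonalProjectionOnto_ones_apply hn (WithLp.toLp 2 y) i
    have h2 := orthogonalProjectionOnto_ones_apply hn (WithLp.toLp 2 y) i'
    change (Py : EuclideanSpace ℝ (Fin (m + 2))) i = _ at h1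
    change (Py : EuclideanSpace ℝ (Fin (m + 2))) i' = _ at h2
    rw [h] at h1 h2
    simp only [Submodule.coe_zero, PiLp.zero_apply] at h1 h2
    exact hi (by linarith)
  have hPy' : 0 < ‖Py‖ := norm_pos_iff.2 hPy0
  have hfin : Module.finrank ℝ W = m + 1 := by
    have : Fact (Module.finrank ℝ (EuclideanSpace ℝ (Fin (m + 2))) = m + 1 + 1) := ⟨by simp⟩
    refine Submodule.finrank_orthogonal_span_singleton fun h => ?_
    have := congrArg (fun z : EuclideanSpace ℝ (Fin (m + 2)) => z 0) h
    simp [onesVector] at this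
  have hT : MeasurableSet {w : W | |inner ℝ w Py / (‖w‖ * ‖Py‖)| ^ 2 < θ} :=
    measurableSet_lt (by fun_prop) (by fun_prop)
  rw [hpi, Measure.map_apply (by fun_prop) hS,
    ← stdGaussian_apply_of_iff (E := W) hm hfin (v := ‖Py‖⁻¹ • Py)
      (by rw [norm_smul, norm_inv, norm_norm, inv_mul_cancel₀ hPy'.ne']) hθ
      (T := {w | |inner ℝ w Py / (‖w‖ * ‖Py‖)| ^ 2 < θ}),
    ← stdGaussian_map_orthogonalProjectionOnto, Measure.map_apply (by fun_prop) hT,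
    ← map_pi_eq_stdGaussian, Measure.map_apply (by fun_prop)
      (hT.preimage (by fun_prop))]
  · congr 1
    ext z
    simp only [Set.mem_preimage, Set.mem_ofPred_eq, sampleCorr_affine hn hs]
    rw [← sampleCorr_eq_inner_div hn (WithLp.toLp 2 z) (WithLp.toLp 2 y)]
  · intro w hw
    have hw' : 0 < ‖w‖ := norm_pos_iff.2 hw
    simp only [Set.mem_ofPred_eq, sq_abs, div_pow, mul_pow, inner_smul_right, inv_pow]
    rw [div_lt_iff₀ (by positivity), inv_mul_lt_iff₀ (by positivity)]
    constructor <;> intro h <;> linarith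

end sampleCorr

/-! ### Exact law of the maximum -/

/-- If `V` has independent components that are independent of `W` and the events `(V j, w) ∈ S`
have the same probability `c` for all `w ∈ B`, these events are conditionally independent with
probability `c` on `{W ∈ B}`. -/
lemma measure_forall_mem_of_indepFun {Ω α β : Type*} [MeasurableSpace Ω] [MeasurableSpace α]
    [MeasurableSpace β] {μ : Measure Ω} [IsProbabilityMeasure μ] {p : ℕ} {V : Ω → Fin p → α}
    {W : Ω → β} (hV : AEMeasurable V μ) (hW : AEMeasurable W μ) (hVW : IndepFun V W μ)
    {ν : Fin p → Measure α} [∀ j, IsProbabilityMeasure (ν j)] (hlaw : μ.map V = Measure.pi ν)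
    {S : Set (α × β)} (hS : MeasurableSet S) {B : Set β} (hB : MeasurableSet B) {c : ENNReal}
    (hc : ∀ w ∈ B, ∀ j, ν j {v | (v, w) ∈ S} = c) :
    μ {ω | W ω ∈ B ∧ ∀ j, (V ω j, W ω) ∈ S} = c ^ p * μ (W ⁻¹' B) := by
  have hT : MeasurableSet {x : (Fin p → α) × β | x.2 ∈ B ∧ ∀ j, (x.1 j, x.2) ∈ S} := by
    rw [Set.ofPred_and, Set.ofPred_forall]
    exact (measurable_snd hB).inter (MeasurableSet.iInter fun j => (by fun_prop :
      Measurable fun x : (Fin p → α) × β => (x.1 j, x.2)) hS)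
  have hlaw2 := (indepFun_iff_map_prod_eq_prod_map_map hV hW).1 hVW
  have := Measure.isProbabilityMeasure_map (μ := μ) hW
  calc μ {ω | W ω ∈ B ∧ ∀ j, (V ω j, W ω) ∈ S}
      = ((Measure.pi ν).prod (μ.map W)) {x | x.2 ∈ B ∧ ∀ j, (x.1 j, x.2) ∈ S} := by
        rw [← hlaw, ← hlaw2, Measure.map_apply_of_aemeasurable (hV.prodMk hW) hT]
        rfl
    _ = ∫⁻ w, B.indicator (fun _ => c ^ p) w ∂μ.map W := by
        rw [Measure.prod_apply_symm hT]
        refine lintegral_congr fun w => ?_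
        by_cases hw : w ∈ B
        -- For fixed `w ∈ B` the section is a box, so its product measure is `c ^ p`.
        · have : (fun x => (x, w)) ⁻¹' {x : (Fin p → α) × β | x.2 ∈ B ∧ ∀ j, (x.1 j, x.2) ∈ S}
              = Set.pi Set.univ fun _ => {v | (v, w) ∈ S} := by
            ext x; simp [hw]
          rw [this, Measure.pi_pi, Set.indicator_of_mem hw]
          simp [hc w hw]
        · simp [hw]
    _ = _ := by rw [lintegral_indicator_const hB, Measure.map_apply_of_aemeasurable hW hB]

lemma iSup_sq_lt_iff {p : ℕ} (hp : 0 < p) (f : Fin p → ℝ) (θ : ℝ) :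
    (⨆ j, |f j|) ^ 2 < θ ↔ ∀ j, |f j| ^ 2 < θ := by
  have : Nonempty (Fin p) := ⟨⟨0, hp⟩⟩
  constructor
  · intro h j
    refine lt_of_le_of_lt ?_ h
    gcongr
    exact le_ciSup (f := fun j => |f j|) (Set.finite_range _).bddAbove j
  · intro h
    obtain ⟨j, hj⟩ := exists_eq_ciSup_of_finite (f := fun j => |f j|)
    rw [← hj]
    exact h j

lemma cosSqDF_nonneg {m : ℕ} (hm : 1 ≤ m) {θ : ℝ} (hθ : 0 < θ) : 0 ≤ cosSqDF m θ := by
  obtain ⟨v, hv⟩ := exists_norm_eq (EuclideanSpace ℝ (Fin (m + 1))) zero_le_one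
  rw [← stdGaussian_real_cone hm (by simp) hv hθ]
  exact measureReal_nonneg

section laws
variable {Ω : Type u} [MeasurableSpace Ω] {μ : Measure Ω} {p m : ℕ}

lemma IsSphereSample.measureReal_maxInner_sq_lt [IsProbabilityMeasure μ]
    (hm : 1 ≤ m) (hp : 0 < p)
    {L : Fin p → Ω → EuclideanSpace ℝ (Fin (m + 1))} {U : Ω → EuclideanSpace ℝ (Fin (m + 1))}
    (h : IsSphereSample L U μ) {θ : ℝ} (hθ : 0 < θ) :
    μ.real {ω | maxInner L U ω ^ 2 < θ} = cosSqDF m θ ^ p := by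
  have := isProbabilityMeasure_uniformSphere (n := m + 1) (by omega)
  have hL : ∀ j, AEMeasurable (L j) μ := fun j => (h.law_L j).aemeasurable
  have hlaw : μ.map (fun ω j => L j ω) = Measure.pi fun _ => uniformSphere (m + 1) := by
    rw [(iIndepFun_iff_map_fun_eq_pi_map hL).1 h.indep_L]
    congr 1
    ext1 j
    exact (h.law_L j).map_eq
  have key := measure_forall_mem_of_indepFun (aemeasurable_pi_lambda _ hL) h.aemeasurable_U
    h.indep_L_U hlaw
    (S := {x | |inner ℝ x.1 x.2| ^ 2 < θ}) (measurableSet_lt (by fun_prop) (by fun_prop))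
    (B := {u | ‖u‖ = 1}) (measurableSet_eq_fun (by fun_prop) (by fun_prop))
    (fun u hu _ => uniformSphere_cap hm hu hθ)
  have hU : μ (U ⁻¹' {u | ‖u‖ = 1}) = 1 := by
    rw [measure_congr (eventuallyEq_univ (s := U ⁻¹' {u | ‖u‖ = 1}).2 h.norm_U), measure_univ]
  rw [hU, mul_one] at key
  have hae : μ {ω | maxInner L U ω ^ 2 < θ}
      = μ {ω | U ω ∈ {u | ‖u‖ = 1} ∧
        ∀ j, (L j ω, U ω) ∈ {x : EuclideanSpace ℝ (Fin (m + 1)) × EuclideanSpace ℝ (Fin (m + 1)) |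
          |inner ℝ x.1 x.2| ^ 2 < θ}} := by
    refine measure_congr ?_
    filter_upwards [h.norm_U] with ω hω
    refine propext ?_
    change maxInner L U ω ^ 2 < θ ↔ ‖U ω‖ = 1 ∧ ∀ j, |inner ℝ (L j ω) (U ω)| ^ 2 < θ
    rw [maxInner, iSup_sq_lt_iff hp]
    simp [hω]
  rw [measureReal_def, hae, key, ENNReal.toReal_pow, ENNReal.toReal_ofReal (cosSqDF_nonneg hm hθ)]

/-- Proved through the inverse map, under which the preimage of a box is a box. -/
lemma map_curry_swap_pi {n : ℕ} (ν : Fin p → Measure ℝ) [∀ j, IsProbabilityMeasure (ν j)] :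
    (Measure.pi fun ij : Fin n × Fin p => ν ij.2).map (fun x j i => x (i, j))
      = Measure.pi fun j => Measure.pi fun _ : Fin n => ν j := by
  have h : (Measure.pi fun j => Measure.pi fun _ : Fin n => ν j).map
      (fun x (ij : Fin n × Fin p) => x ij.2 ij.1) = Measure.pi fun ij : Fin n × Fin p => ν ij.2 := by
    refine (Measure.pi_eq fun s hs => ?_).symm
    rw [Measure.map_apply (by fun_prop) (MeasurableSet.univ_pi hs)]
    have : (fun (x : Fin p → Fin n → ℝ) (ij : Fin n × Fin p) => x ij.2 ij.1) ⁻¹' Set.univ.pi s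
        = Set.univ.pi fun j => Set.univ.pi fun i => s (i, j) := by
      ext x
      simp only [Set.mem_preimage, Set.mem_univ_pi, Prod.forall]
      exact forall_comm
    rw [this, Measure.pi_pi]
    simp_rw [Measure.pi_pi]
    rw [Fintype.prod_prod_type_right]
  rw [← h, Measure.map_map (by fun_prop) (by fun_prop)]
  exact Measure.map_id

lemma measurableSet_nonconst_id (n : ℕ) :
    MeasurableSet {y : Fin n → ℝ | ∃ i i', y i ≠ y i'} := by
  simp only [Set.ofPred_exists]
  exact MeasurableSet.iUnion fun i => MeasurableSet.iUnion fun i' =>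
    (measurableSet_eq_fun (by fun_prop) (by fun_prop)).compl

lemma IsGaussianSample.aemeasurable_Y {n : ℕ} {X : Fin n → Fin p → Ω → ℝ} {Y : Fin n → Ω → ℝ}
    (h : IsGaussianSample X Y μ) : AEMeasurable (fun ω i => Y i ω) μ :=
  aemeasurable_pi_lambda _ fun i => (h.identDistrib_Y i i).aemeasurable_fst

lemma IsGaussianSample.nullMeasurableSet_nonconst {n : ℕ} {X : Fin n → Fin p → Ω → ℝ}
    {Y : Fin n → Ω → ℝ} (h : IsGaussianSample X Y μ) : NullMeasurableSet (nonconst Y) μ :=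
  h.aemeasurable_Y.nullMeasurableSet_preimage (measurableSet_nonconst_id n)

/-- Given any nonconstant sample of `Y`, each event `Ĉ² < θ` has the same probability, whatever the
mean and variance of `X_j`; hence the factorization. -/
lemma IsGaussianSample.measureReal_nonconst_inter_maxCorr_sq_lt [IsProbabilityMeasure μ]
    (hm : 1 ≤ m) (hp : 0 < p)
    {X : Fin (m + 2) → Fin p → Ω → ℝ} {Y : Fin (m + 2) → Ω → ℝ}
    (h : IsGaussianSample X Y μ) {θ : ℝ} (hθ : 0 < θ) :
    μ.real (nonconst Y ∩ {ω | maxCorr X Y ω ^ 2 < θ})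
      = cosSqDF m θ ^ p * μ.real (nonconst Y) := by
  choose μ₀ v hv hX using h.law_X
  have hXm : ∀ ij : Fin (m + 2) × Fin p, AEMeasurable (X ij.1 ij.2) μ :=
    fun ij => (hX ij.2 ij.1).aemeasurable
  have hlaw0 : μ.map (fun ω (ij : Fin (m + 2) × Fin p) => X ij.1 ij.2 ω)
      = Measure.pi fun ij : Fin (m + 2) × Fin p => gaussianReal (μ₀ ij.2) (v ij.2) := by
    rw [(iIndepFun_iff_map_fun_eq_pi_map hXm).1 h.indep_X]
    congr 1
    ext1 ij
    exact (hX ij.2 ij.1).map_eq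
  have hcurry : Measurable fun (x : Fin (m + 2) × Fin p → ℝ) (j : Fin p) (i : Fin (m + 2)) =>
    x (i, j) := by fun_prop
  have hlaw : μ.map (fun ω j i => X i j ω)
      = Measure.pi fun j => Measure.pi fun _ : Fin (m + 2) => gaussianReal (μ₀ j) (v j) := by
    rw [← map_curry_swap_pi, ← hlaw0,
      AEMeasurable.map_map_of_aemeasurable hcurry.aemeasurable (aemeasurable_pi_lambda _ hXm)]
    rfl
  have key := measure_forall_mem_of_indepFun
    (aemeasurable_pi_lambda _ fun j => aemeasurable_pi_lambda _ fun i => hXm (i, j))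
    h.aemeasurable_Y (h.indep_X_Y.comp hcurry measurable_id) hlaw
    (S := {x : (Fin (m + 2) → ℝ) × (Fin (m + 2) → ℝ) | |sampleCorr x.1 x.2| ^ 2 < θ})
    (measurableSet_lt (by simp only [sq_abs]; fun_prop) (by fun_prop))
    (measurableSet_nonconst_id (m + 2))
    (fun y hy j => pi_gaussianReal_sampleCorr hm (μ₀ j) (hv j) hy hθ)
  have hset : nonconst Y ∩ {ω | maxCorr X Y ω ^ 2 < θ}
      = {ω | (fun i => Y i ω) ∈ {y : Fin (m + 2) → ℝ | ∃ i i', y i ≠ y i'} ∧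
        ∀ j, ((fun i => X i j ω), fun i => Y i ω) ∈
          {x : (Fin (m + 2) → ℝ) × (Fin (m + 2) → ℝ) | |sampleCorr x.1 x.2| ^ 2 < θ}} := by
    ext ω
    change _ ∧ maxCorr X Y ω ^ 2 < θ ↔ _ ∧ ∀ j, _
    rw [maxCorr, iSup_sq_lt_iff hp]
    rfl
  rw [measureReal_def, hset]
  refine (congrArg ENNReal.toReal key).trans ?_
  rw [ENNReal.toReal_mul, ENNReal.toReal_pow, ENNReal.toReal_ofReal (cosSqDF_nonneg hm hθ)]
  rfl

lemma IsGaussianSample.cond_real_maxCorr_sq_lt [IsProbabilityMeasure μ]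
    (hm : 1 ≤ m) (hp : 0 < p)
    {X : Fin (m + 2) → Fin p → Ω → ℝ} {Y : Fin (m + 2) → Ω → ℝ}
    (h : IsGaussianSample X Y μ) (hY : μ (nonconst Y) ≠ 0) {θ : ℝ} (hθ : 0 < θ) :
    (cond μ (nonconst Y)).real {ω | maxCorr X Y ω ^ 2 < θ} = cosSqDF m θ ^ p := by
  have h0 : μ.real (nonconst Y) ≠ 0 := by
    rw [measureReal_def]
    exact ENNReal.toReal_ne_zero.2 ⟨hY, measure_ne_top _ _⟩
  have h1 := h.measureReal_nonconst_inter_maxCorr_sq_lt hm hp hθ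
  rw [measureReal_def, ProbabilityTheory.cond, Measure.smul_apply,
    Measure.restrict_apply₀' h.nullMeasurableSet_nonconst, smul_eq_mul, ENNReal.toReal_mul,
    ENNReal.toReal_inv, Set.inter_comm, ← measureReal_def, ← measureReal_def, h1]
  field_simp

end laws

/-! ### From uniform bounds to limits -/

/-- The difference is the mass of `S \ D`, at most that of the complement of `D`. -/
lemma abs_measureReal_sub_mul_cond_le {Ω : Type*} [MeasurableSpace Ω] {μ : Measure Ω}
    [IsProbabilityMeasure μ] {D : Set Ω} (hD : NullMeasurableSet D μ) (hD0 : μ D ≠ 0) (S : Set Ω) :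
    |μ.real S - μ.real D * (ProbabilityTheory.cond μ D).real S| ≤ 1 - μ.real D := by
  have h0 : μ.real D ≠ 0 := by
    rw [measureReal_def]
    exact ENNReal.toReal_ne_zero.2 ⟨hD0, measure_ne_top _ _⟩
  have h1 : μ.real D * (ProbabilityTheory.cond μ D).real S = μ.real (S ∩ D) := by
    rw [measureReal_def (ProbabilityTheory.cond μ D), ProbabilityTheory.cond, Measure.smul_apply,
      Measure.restrict_apply₀' hD, smul_eq_mul, ENNReal.toReal_mul, ENNReal.toReal_inv,
      ← measureReal_def, ← measureReal_def, mul_inv_cancel_left₀ h0]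
  have h2 := measureReal_inter_add_sdiff₀ (μ := μ) (s := S) hD
  have h3 : μ.real (S \ D) ≤ μ.real Dᶜ := measureReal_mono fun _ h => h.2
  rw [h1, ← probReal_compl_eq_one_sub₀ hD, ← h2, add_sub_cancel_left, abs_of_nonneg measureReal_nonneg]
  exact h3

lemma setOf_div_lt_eq {Ω : Type*} {a b : ℝ} (hb : 0 < b) (f : Ω → ℝ) (x : ℝ) :
    {ω | (f ω - a) / b < x} = {ω | f ω < a + b * x} := by
  ext ω
  simp only [Set.mem_ofPred_eq]
  rw [div_lt_iff₀ hb, sub_lt_iff_lt_add', mul_comm b x]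

/-- A family bounded by `approxBound` uniformly in the dimension converges uniformly. -/
lemma tendsto_iSup_of_approxBound {x : ℝ} {k : ℕ} {f : ℕ → ℕ → ℝ}
    (hf0 : ∀ p n, 0 ≤ f p n)
    (hf : ∀ᶠ p : ℕ in atTop, ∀ n, k ≤ n → f p n ≤ approxBound p x) :
    Tendsto (fun p : ℕ => ⨆ n : {n : ℕ // k ≤ n}, f p n) atTop (𝓝 0) := by
  refine tendsto_of_tendsto_of_tendsto_of_le_of_le' tendsto_const_nhds (tendsto_approxBound x)
    (Eventually.of_forall fun p => Real.iSup_nonneg fun n => hf0 p n) ?_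
  have : Nonempty {n : ℕ // k ≤ n} := ⟨⟨k, le_rfl⟩⟩
  filter_upwards [hf] with p hp
  exact ciSup_le fun n => hp n n.2

lemma tendsto_prod_of_approxBound {x : ℝ} {k d : ℕ} {f : ℕ → ℕ → ℝ}
    (hf : ∀ᶠ p : ℕ in atTop, ∀ n, k ≤ n → |f p n - limitDF (n - d) x| ≤ approxBound p x) :
    Tendsto (fun q : ℕ × ℕ => f q.1 q.2) (atTop ×ˢ atTop) (𝓝 (Real.exp (-Real.exp (-x)))) := by
  have h1 : Tendsto (fun q : ℕ × ℕ => limitDF (q.2 - d) x) (atTop ×ˢ atTop)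
      (𝓝 (Real.exp (-Real.exp (-x)))) :=
    ((tendsto_limitDF x).comp (tendsto_sub_atTop_nat d)).comp tendsto_snd
  have h2 : Tendsto (fun q : ℕ × ℕ => f q.1 q.2 - limitDF (q.2 - d) x) (atTop ×ˢ atTop) (𝓝 0) := by
    refine squeeze_zero_norm' ?_ ((tendsto_approxBound x).comp tendsto_fst)
    filter_upwards [hf.prod_mk (eventually_ge_atTop k)] with q hq
    exact hq.1 q.2 hq.2
  simpa using h2.add h1

end

theorem theorem3 :
    -- Part 1: the maximal independent inner product
    (∀ (Ω : ℕ → ℕ → Type u) [∀ p n, MeasurableSpace (Ω p n)]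
      (μ : ∀ p n, Measure (Ω p n)) [∀ p n, IsProbabilityMeasure (μ p n)]
      (L : ∀ p n, Fin p → Ω p n → EuclideanSpace ℝ (Fin n))
      (U : ∀ p n, Ω p n → EuclideanSpace ℝ (Fin n)),
      (∀ p n, 2 ≤ n → IsSphereSample (L p n) (U p n) (μ p n)) →
      ∀ x : ℝ,
        Tendsto (fun p : ℕ => ⨆ n : {n : ℕ // 2 ≤ n},
          |(μ p n).real {ω | (maxInner (L p n) (U p n) ω ^ 2 - aConst p n) / bConst p n < x}
            - limitDF n x|) atTop (𝓝 0) ∧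
        Tendsto (fun q : ℕ × ℕ => (μ q.1 q.2).real
          {ω | (maxInner (L q.1 q.2) (U q.1 q.2) ω ^ 2 - aConst q.1 q.2) / bConst q.1 q.2 < x})
          (atTop ×ˢ atTop) (𝓝 (Real.exp (-Real.exp (-x))))) ∧
    -- Part 2: the maximal spurious correlation
    (∀ (Ω : ℕ → ℕ → Type u) [∀ p n, MeasurableSpace (Ω p n)]
      (μ : ∀ p n, Measure (Ω p n)) [∀ p n, IsProbabilityMeasure (μ p n)]
      (X : ∀ p n, Fin n → Fin p → Ω p n → ℝ) (Y : ∀ p n, Fin n → Ω p n → ℝ),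
      (∀ p n, 3 ≤ n → IsGaussianSample (X p n) (Y p n) (μ p n)) →
      (∀ p n, 3 ≤ n → μ p n (nonconst (Y p n)) ≠ 0) →
      ∀ x : ℝ,
        -- conditionally on the sample correlations being defined, for every nondegenerate `Y`
        Tendsto (fun p : ℕ => ⨆ n : {n : ℕ // 3 ≤ n},
          |(cond (μ p n) (nonconst (Y p n))).real
              {ω | (maxCorr (X p n) (Y p n) ω ^ 2 - aConst p (n - 1)) / bConst p (n - 1) < x}
            - limitDF (n - 1) x|) atTop (𝓝 0) ∧
        Tendsto (fun q : ℕ × ℕ => (cond (μ q.1 q.2) (nonconst (Y q.1 q.2))).real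
          {ω | (maxCorr (X q.1 q.2) (Y q.1 q.2) ω ^ 2 - aConst q.1 (q.2 - 1))
            / bConst q.1 (q.2 - 1) < x})
          (atTop ×ˢ atTop) (𝓝 (Real.exp (-Real.exp (-x)))) ∧
        -- unconditionally, uniformly in `n`, if they are almost surely defined
        ((∀ p n, 3 ≤ n → ∀ᵐ ω ∂(μ p n), ω ∈ nonconst (Y p n)) →
          Tendsto (fun p : ℕ => ⨆ n : {n : ℕ // 3 ≤ n},
            |(μ p n).real
                {ω | (maxCorr (X p n) (Y p n) ω ^ 2 - aConst p (n - 1)) / bConst p (n - 1) < x}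
              - limitDF (n - 1) x|) atTop (𝓝 0)) ∧
        -- unconditionally, as `n, p → ∞`, if they are defined with probability tending to one
        (Tendsto (fun q : ℕ × ℕ => (μ q.1 q.2).real (nonconst (Y q.1 q.2)))
            (atTop ×ˢ atTop) (𝓝 1) →
          Tendsto (fun q : ℕ × ℕ => (μ q.1 q.2).real
            {ω | (maxCorr (X q.1 q.2) (Y q.1 q.2) ω ^ 2 - aConst q.1 (q.2 - 1))
              / bConst q.1 (q.2 - 1) < x})
            (atTop ×ˢ atTop) (𝓝 (Real.exp (-Real.exp (-x)))))) := by
  refine ⟨fun Ω _ μ _ L U h x => ?_, fun Ω _ μ _ X Y h hY x => ?_⟩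
  -- The index `n - 0` fits the shift `d = 0` of `tendsto_prod_of_approxBound`; the correlations use
  -- `d = 1`.
  · have hbound : ∀ᶠ p : ℕ in atTop, ∀ n, 2 ≤ n →
        |(μ p n).real {ω | (maxInner (L p n) (U p n) ω ^ 2 - aConst p n) / bConst p n < x}
          - limitDF (n - 0) x| ≤ approxBound p x := by
      filter_upwards [eventually_abs_cosSqDF_pow_sub_limitDF_le x, eventually_gt_atTop 0]
        with p hp hp0 n hn
      obtain ⟨m, rfl⟩ : ∃ m, n = m + 1 := ⟨n - 1, by omega⟩
      obtain ⟨hb, hθ, hle⟩ := hp m (by omega)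
      rw [setOf_div_lt_eq hb, (h p (m + 1) hn).measureReal_maxInner_sq_lt (by omega) hp0 hθ]
      exact hle
    exact ⟨tendsto_iSup_of_approxBound (f := fun p n => |(μ p n).real
        {ω | (maxInner (L p n) (U p n) ω ^ 2 - aConst p n) / bConst p n < x} - limitDF n x|)
        (fun _ _ => abs_nonneg _) hbound,
      tendsto_prod_of_approxBound (f := fun p n => (μ p n).real
        {ω | (maxInner (L p n) (U p n) ω ^ 2 - aConst p n) / bConst p n < x}) hbound⟩
  · have hbound : ∀ᶠ p : ℕ in atTop, ∀ n, 3 ≤ n →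
        |(cond (μ p n) (nonconst (Y p n))).real
          {ω | (maxCorr (X p n) (Y p n) ω ^ 2 - aConst p (n - 1)) / bConst p (n - 1) < x}
          - limitDF (n - 1) x| ≤ approxBound p x := by
      filter_upwards [eventually_abs_cosSqDF_pow_sub_limitDF_le x, eventually_gt_atTop 0]
        with p hp hp0 n hn
      -- Centering costs one dimension: `n = m + 2` observations give directions in `ℝ^(m+1)`.
      obtain ⟨m, rfl⟩ : ∃ m, n = m + 2 := ⟨n - 2, by omega⟩
      obtain ⟨hb, hθ, hle⟩ := hp m (by omega)
      rw [show m + 2 - 1 = m + 1 by omega, setOf_div_lt_eq hb,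
        (h p (m + 2) hn).cond_real_maxCorr_sq_lt (by omega) hp0 (hY p (m + 2) hn) hθ]
      exact hle
    have hcond := tendsto_prod_of_approxBound (f := fun p n =>
      (cond (μ p n) (nonconst (Y p n))).real
        {ω | (maxCorr (X p n) (Y p n) ω ^ 2 - aConst p (n - 1)) / bConst p (n - 1) < x}) hbound
    refine ⟨tendsto_iSup_of_approxBound (f := fun p n => |(cond (μ p n) (nonconst (Y p n))).real
        {ω | (maxCorr (X p n) (Y p n) ω ^ 2 - aConst p (n - 1)) / bConst p (n - 1) < x}
        - limitDF (n - 1) x|) (fun _ _ => abs_nonneg _) hbound, hcond, fun hD => ?_, fun hD => ?_⟩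
    · refine tendsto_iSup_of_approxBound (x := x) (f := fun p n => |(μ p n).real
        {ω | (maxCorr (X p n) (Y p n) ω ^ 2 - aConst p (n - 1)) / bConst p (n - 1) < x}
        - limitDF (n - 1) x|) (fun _ _ => abs_nonneg _) ?_
      filter_upwards [hbound] with p hp n hn
      have : cond (μ p n) (nonconst (Y p n)) = μ p n := by
        rw [ProbabilityTheory.cond, Measure.restrict_eq_self_of_ae_mem (hD p n hn),
          show μ p n (nonconst (Y p n)) = 1 by
            rw [measure_congr (eventuallyEq_univ (s := nonconst (Y p n)).2 (hD p n hn)), measure_univ], inv_one, one_smul]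
      rw [← this]
      exact hp n hn
    · have hdiff : Tendsto (fun q : ℕ × ℕ => (μ q.1 q.2).real
          {ω | (maxCorr (X q.1 q.2) (Y q.1 q.2) ω ^ 2 - aConst q.1 (q.2 - 1))
            / bConst q.1 (q.2 - 1) < x} - (μ q.1 q.2).real (nonconst (Y q.1 q.2)) *
          (cond (μ q.1 q.2) (nonconst (Y q.1 q.2))).real
            {ω | (maxCorr (X q.1 q.2) (Y q.1 q.2) ω ^ 2 - aConst q.1 (q.2 - 1))
              / bConst q.1 (q.2 - 1) < x}) (atTop ×ˢ atTop) (𝓝 0) := by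
        -- The difference is at most `1 - P(D)`, which tends to `0` by assumption.
        refine squeeze_zero_norm' ?_ (by simpa using hD.const_sub 1)
        filter_upwards [tendsto_snd.eventually (eventually_ge_atTop 3)] with q hq
        exact abs_measureReal_sub_mul_cond_le (h q.1 q.2 hq).nullMeasurableSet_nonconst
          (hY q.1 q.2 hq) _
      simpa using hdiff.add (hD.mul hcond)
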